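/- Let $p$ be a prime, let $k$ be a field of characteristic $p$, and let $G=\langle\sigma\rangle$ be a cyclic group of order $p$ with identity $e$. Write $[a,b]=ab-ba$ and consider the $k$-algebras \[\Lambda_1=k\langle y,z\rangle/\langle y^p,\;yz-zy,\;z^p\rangle,\qquad \Lambda_2=k\langle y,z\rangle/\langle y^p,\;yz-zy-y^2,\;z^p\rangle,\] \[\mathbf{B1},\ \mathbf{C11}:\quad k\langle x,y,z\rangle/\langle [x,y]-y,\;[x,z],\;[y,z],\;x^p-x,\;y^p,\;z^p\rangle,\] \[\mathbf{B3}:\quad k\langle x,y,z\rangle/\langle [x,y]-y,\;[x,z]-z,\;[y,z]-y^2,\;x^p-x,\;y^p,\;z^p\rangle,\] \[\mathbf{C16}:\quad C(\lambda,\delta)=k\langle x,y,z\rangle/\langle [x,y],\;[x,z]-\lambda x,\;[y,z]-\lambda^{-1}y,\;x^p,\;y^p,\;z^p-\delta z\rangle,\] where $\lambda\in k^\times$ and $\delta=\lambda^{p-1}=\pm1$. Coverings. Let $Q$ be a finite quiver; in the path algebra $kQ$ the path $a_n\cdots a_1$ runs first through $a_1$ and last through $a_n$. Let $J$ be the ideal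 of $kQ$ generated by the arrows, and let $I$ be an admissible ideal ($J^m\subseteq I\subseteq J^2$ for some $m\ge 2$). Let $w\colon Q_1\to G$ be a function; put $w(a_n\cdots a_1)=w(a_1)\cdots w(a_n)$ for non-trivial paths and $w=e$ on trivial paths, and assume that $I$ is generated by weight-homogeneous elements. The covering quiver $\widetilde Q(w)$ has vertices $(v,g)$ with $v\in Q_0$, $g\in G$, and an arrow $(a,g)\colon(\mathfrak o(a),g)\to(\mathfrak t(a),g\,w(a))$ for all $a\in Q_1$, $g\in G$, where $\mathfrak o(a)$ and $\mathfrak t(a)$ are the origin and the terminus of $a$. Each path $q$ in $Q$ has, for each $g\in G$, a unique lifting starting in $(\mathfrak o(q),g)$; extend these liftings linearly to $kQ$ and let $\widetilde I(w)$ be the ideal of $k\widetilde Q(w)$ generated by all liftings of weight-homogeneous elements of $I$. The covering of $kQ/I$ with weight function $w$ is $k\widetilde Q(w)/\widetilde I(w)$. The algebras $\Lambda_1,\Lambda_2$ are regarded as quotients of the path algebra of the quiver with one vertex and two loops $y,z$. Then $\Lambda_1$ and $\Lambda_2$ are local, their defining ideals are admissible and are weight-homogeneous for the weight functions below, and the following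 hold. (a) The algebras $\mathbf{B1}$ and $\mathbf{C11}$ are isomorphic, and they are isomorphic to the covering of $\Lambda_1$ with weight function $w(y)=\sigma$, $w(z)=e$. (b) The algebra $\mathbf{B3}$ is isomorphic to the covering of $\Lambda_2$ with weight function $w(y)=w(z)=\sigma$. (c) For every $\lambda\in k^\times$ with $\delta=\lambda^{p-1}=\pm1$ there is a unique integer $a$ with $1\le a\le p-1$ and $\lambda^{-1}=a\lambda$ in $k$; and for every integer $a$ with $\lambda^{-1}=a\lambda$ in $k$, the algebra $C(\lambda,\delta)$ is isomorphic to the covering of $\Lambda_1$ with weight function $w(y)=\sigma^{-1}$, $w(z)=\sigma^{-a}$. -/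

import Mathlib

namespace PathCovering

universe u v

/-! ### Path algebras -/

/-- A path of a quiver, together with its source and its target. -/
structure QPath (V : Type u) [Quiver.{v} V] where
  source : V
  target : V
  path : Quiver.Path source target

/-- The vector space underlying the path algebra `kQ`: it has the set of all paths as a basis. -/
def PathAlgebra (k : Type*) [Field k] (V : Type u) [Quiver.{v} V] : Type _ :=
  QPath V →₀ k

section PathAlgebra

variable (k : Type*) [Field k] {V : Type u} [Quiver.{v} V]

noncomputable instance : AddCommGroup (PathAlgebra k V) :=
  inferInstanceAs (AddCommGroup (QPath V →₀ k))

noncomputable instance : Module k (PathAlgebra k V) :=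
  inferInstanceAs (Module k (QPath V →₀ k))

/-- The basis of the path algebra formed by the paths. -/
noncomputable def pathBasis (V : Type u) [Quiver.{v} V] :
    Module.Basis (QPath V) k (PathAlgebra k V) :=
  Module.Basis.ofRepr (LinearEquiv.refl k (QPath V →₀ k))

/-- The basis element of the path algebra given by a path from `a` to `b`. -/
noncomputable def ofPath {a b : V} (p : Quiver.Path a b) : PathAlgebra k V :=
  pathBasis k V ⟨a, b, p⟩

open Classical in
/-- The product `p * q` of two paths: first `q`, then `p`, if `q` ends where `p` starts, and zero
otherwise. -/
noncomputable def pathMul (p q : QPath V) : PathAlgebra k V :=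
  if h : q.target = p.source then ofPath k (q.path.comp (p.path.cast h.symm rfl)) else 0

/-- The bilinear extension of the product of paths. -/
noncomputable def mulLinear : PathAlgebra k V →ₗ[k] PathAlgebra k V →ₗ[k] PathAlgebra k V :=
  (pathBasis k V).constr k (fun p => (pathBasis k V).constr k (fun q => pathMul k p q))

noncomputable instance : Mul (PathAlgebra k V) := ⟨fun x y => mulLinear k x y⟩

/-- The identity of the path algebra is the sum of all trivial paths. -/
noncomputable instance [Fintype V] : One (PathAlgebra k V) :=
  ⟨∑ a : V, ofPath k (Quiver.Path.nil : Quiver.Path a a)⟩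

theorem mul_def (x y : PathAlgebra k V) : x * y = mulLinear k x y := rfl

theorem one_def [Fintype V] :
    (1 : PathAlgebra k V) = ∑ a : V, ofPath k (Quiver.Path.nil : Quiver.Path a a) := rfl

theorem mulLinear_ofPath {a b c d : V} (p : Quiver.Path a b) (q : Quiver.Path c d) :
    mulLinear k (ofPath k p) (ofPath k q) = pathMul k ⟨a, b, p⟩ ⟨c, d, q⟩ := by
  simp [mulLinear, ofPath]

theorem ofPath_mul_ofPath {a b c : V} (p : Quiver.Path b c) (q : Quiver.Path a b) :
    ofPath k p * ofPath k q = ofPath k (q.comp p) := by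
  rw [mul_def, mulLinear_ofPath]
  simp [pathMul]

theorem ofPath_mul_ofPath_of_ne {a b c d : V} (p : Quiver.Path a b) (q : Quiver.Path c d)
    (h : d ≠ a) : ofPath k p * ofPath k q = 0 := by
  rw [mul_def, mulLinear_ofPath]
  simp [pathMul, h]

variable {k}

@[elab_as_elim]
theorem induction_on {P : PathAlgebra k V → Prop} (x : PathAlgebra k V) (zero : P 0)
    (add : ∀ x y, P x → P y → P (x + y))
    (path : ∀ (r : k) {a b : V} (p : Quiver.Path a b), P (r • ofPath k p)) : P x := by
  rw [← (pathBasis k V).linearCombination_repr x]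
  refine Finsupp.induction_linear ((pathBasis k V).repr x) ?_ ?_ ?_
  · simpa using zero
  · intro f g hf hg
    simpa using add _ _ hf hg
  · rintro ⟨a, b, p⟩ r
    simpa [ofPath] using path r p

variable (k)

theorem ofPath_mul_assoc {a b c d e f : V} (p : Quiver.Path a b) (q : Quiver.Path c d)
    (r : Quiver.Path e f) :
    ofPath k p * ofPath k q * ofPath k r = ofPath k p * (ofPath k q * ofPath k r) := by
  by_cases h : d = a
  · subst h
    rw [ofPath_mul_ofPath]
    by_cases h' : f = c
    · subst h'
      rw [ofPath_mul_ofPath, ofPath_mul_ofPath, ofPath_mul_ofPath, Quiver.Path.comp_assoc]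
    · rw [ofPath_mul_ofPath_of_ne k _ _ h', ofPath_mul_ofPath_of_ne k _ _ h', mul_def k _ 0,
        map_zero]
  · rw [ofPath_mul_ofPath_of_ne k _ _ h, mul_def k 0, map_zero, LinearMap.zero_apply]
    by_cases h' : f = c
    · subst h'
      rw [ofPath_mul_ofPath, ofPath_mul_ofPath_of_ne k _ _ h]
    · rw [ofPath_mul_ofPath_of_ne k _ _ h', mul_def k _ 0, map_zero]

theorem pathAlgebra_mul_assoc (x y z : PathAlgebra k V) : x * y * z = x * (y * z) := by
  induction x using induction_on with
  | zero => simp [mul_def]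
  | add x₁ x₂ h₁ h₂ => simp only [mul_def, map_add, LinearMap.add_apply] at h₁ h₂ ⊢; rw [h₁, h₂]
  | path r p =>
    induction y using induction_on with
    | zero => simp [mul_def]
    | add x₁ x₂ h₁ h₂ => simp only [mul_def, map_add, LinearMap.add_apply] at h₁ h₂ ⊢; rw [h₁, h₂]
    | path s q =>
      induction z using induction_on with
      | zero => simp [mul_def]
      | add x₁ x₂ h₁ h₂ => simp only [mul_def, map_add] at h₁ h₂ ⊢; rw [h₁, h₂]
      | path t l =>
        have h := ofPath_mul_assoc k p q l
        simp only [mul_def, map_smul, LinearMap.smul_apply] at h ⊢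
        rw [h]

theorem pathAlgebra_one_mul [Fintype V] (x : PathAlgebra k V) : 1 * x = x := by
  induction x using induction_on with
  | zero => simp [mul_def]
  | add x₁ x₂ h₁ h₂ => rw [mul_def] at h₁ h₂ ⊢; rw [map_add, h₁, h₂]
  | @path r a b p =>
    rw [mul_def, map_smul, one_def, map_sum, LinearMap.sum_apply,
      Finset.sum_eq_single_of_mem b (Finset.mem_univ b)]
    · rw [← mul_def, ofPath_mul_ofPath, Quiver.Path.comp_nil]
    · intro c _ hc
      rw [← mul_def, ofPath_mul_ofPath_of_ne k _ _ hc.symm]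

theorem pathAlgebra_mul_one [Fintype V] (x : PathAlgebra k V) : x * 1 = x := by
  induction x using induction_on with
  | zero => simp [mul_def]
  | add x₁ x₂ h₁ h₂ => rw [mul_def] at h₁ h₂ ⊢; rw [map_add, LinearMap.add_apply, h₁, h₂]
  | @path r a b p =>
    rw [mul_def, map_smul, LinearMap.smul_apply, one_def, map_sum,
      Finset.sum_eq_single_of_mem a (Finset.mem_univ a)]
    · rw [← mul_def, ofPath_mul_ofPath, Quiver.Path.nil_comp]
    · intro c _ hc
      rw [← mul_def, ofPath_mul_ofPath_of_ne k _ _ hc]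

noncomputable instance [Fintype V] : Ring (PathAlgebra k V) :=
  { (inferInstance : AddCommGroup (PathAlgebra k V)) with
    mul := (· * ·)
    one := 1
    mul_assoc := pathAlgebra_mul_assoc k
    one_mul := pathAlgebra_one_mul k
    mul_one := pathAlgebra_mul_one k
    left_distrib := fun x y z => by simp [mul_def]
    right_distrib := fun x y z => by simp [mul_def]
    zero_mul := fun x => by simp [mul_def]
    mul_zero := fun x => by simp [mul_def] }

noncomputable instance [Fintype V] : Algebra k (PathAlgebra k V) :=
  Algebra.ofModule
    (fun r x y => by simp [mul_def])
    (fun r x y => by simp [mul_def])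

end PathAlgebra

/-! ### Admissible ideals, weights and coverings -/

/-- The arrow ideal of `kQ`, spanned by the paths of positive length. -/
noncomputable def arrowIdeal (k : Type*) [Field k] (V : Type u) [Quiver.{v} V] :
    Submodule k (PathAlgebra k V) :=
  Submodule.span k {x | ∃ (a b : V) (p : Quiver.Path a b), 1 ≤ p.length ∧ x = ofPath k p}

/-- An ideal `I` of `kQ` is admissible if `J ^ m ⊆ I ⊆ J ^ 2` for some `m ≥ 2`, where `J` is the
arrow ideal. -/
def IsAdmissible {k : Type*} [Field k] {V : Type u} [Quiver.{v} V] [Fintype V]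
    (I : TwoSidedIdeal (PathAlgebra k V)) : Prop :=
  (∃ m : ℕ, 2 ≤ m ∧ ∀ x ∈ arrowIdeal k V ^ m, x ∈ I) ∧ ∀ x ∈ I, x ∈ arrowIdeal k V ^ 2

section Covering

variable (k : Type*) [Field k] {V : Type u} [Quiver.{v} V] {G : Type*} [Group G]
  (w : ∀ ⦃a b : V⦄, (a ⟶ b) → G)

/-- The weight of a path `aₙ ⋯ a₂ a₁` (first `a₁`, last `aₙ`) is `w a₁ * w a₂ * ⋯ * w aₙ`; the
weight of a trivial path is the identity. -/
def pathWeight {a b : V} (p : Quiver.Path a b) : G :=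
  Quiver.Path.weight (fun {i j} (e : i ⟶ j) => w e) p

theorem pathWeight_nil (a : V) : pathWeight w (Quiver.Path.nil : Quiver.Path a a) = 1 := by
  simp [pathWeight]

theorem pathWeight_cons {a b c : V} (p : Quiver.Path a b) (e : b ⟶ c) :
    pathWeight w (p.cons e) = pathWeight w p * w e := by
  simp [pathWeight]

/-- An element of `kQ` is weight homogeneous of weight `g` if all paths occurring in it have
weight `g`. -/
def IsWeightHomogeneous {k : Type*} [Field k] (g : G) (x : PathAlgebra k V) : Prop :=
  ∀ q ∈ ((pathBasis k V).repr x).support, pathWeight w q.path = g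

/-- An ideal of `kQ` is weight homogeneous if it is generated by weight homogeneous elements. -/
def IsWeightHomogeneousIdeal {k : Type*} [Field k] [Fintype V]
    (I : TwoSidedIdeal (PathAlgebra k V)) : Prop :=
  ∃ S : Set (PathAlgebra k V),
    (∀ x ∈ S, ∃ g : G, IsWeightHomogeneous w g x) ∧ I = TwoSidedIdeal.span S

/-- The vertices `(v, g)` of the covering quiver. -/
@[ext, nolint unusedArguments]
structure CoverVertex (w : ∀ ⦃a b : V⦄, (a ⟶ b) → G) where
  vertex : V
  sheet : G

/-- The vertices of the covering quiver are the pairs `(v, g)`. -/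
def coverVertexEquiv : CoverVertex w ≃ V × G where
  toFun s := (s.vertex, s.sheet)
  invFun s := ⟨s.1, s.2⟩

instance [Fintype V] [Fintype G] : Fintype (CoverVertex w) :=
  Fintype.ofEquiv (V × G) (coverVertexEquiv w).symm

/-- The arrows of the covering quiver: an arrow `(a, g) : (o(a), g) ⟶ (t(a), g * w a)` for every
arrow `a` of the quiver and every `g` in the group. -/
instance : Quiver.{v} (CoverVertex w) where
  Hom s t := {a : s.vertex ⟶ t.vertex // s.sheet * w a = t.sheet}

/-- The lift of a path to the covering quiver starting in `(o(p), g)`; it ends in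
`(t(p), g * w(p))`. -/
def liftPath (g : G) {a : V} : ∀ {b : V} (p : Quiver.Path a b),
    Quiver.Path (CoverVertex.mk (w := w) a g) (CoverVertex.mk (w := w) b (g * pathWeight w p))
  | _, Quiver.Path.nil =>
      (Quiver.Path.nil : Quiver.Path (CoverVertex.mk (w := w) a g) _).cast rfl
        (congrArg (CoverVertex.mk (w := w) a) ((congrArg (g * ·) (pathWeight_nil w a)).trans (mul_one g)).symm)
  | _, Quiver.Path.cons p e =>
      (liftPath g p).cons ⟨e, (mul_assoc g (pathWeight w p) (w e)).trans
        (congrArg (g * ·) (pathWeight_cons w p e)).symm⟩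

/-- The linear extension `kQ → kQ~` of the lifting of paths starting in the sheet `g`. -/
noncomputable def lift (g : G) : PathAlgebra k V →ₗ[k] PathAlgebra k (CoverVertex w) :=
  (pathBasis k V).constr k (fun q => ofPath k (liftPath w g q.path))

variable {k}

/-- The ideal of the path algebra of the covering quiver generated by all the liftings of weight
homogeneous elements of `I`. -/
noncomputable def liftIdeal [Fintype V] [Fintype G] (I : TwoSidedIdeal (PathAlgebra k V)) :
    TwoSidedIdeal (PathAlgebra k (CoverVertex w)) :=
  TwoSidedIdeal.span {x | ∃ (g h : G) (r : PathAlgebra k V),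
    r ∈ I ∧ IsWeightHomogeneous w h r ∧ x = lift k w g r}

/-- `A` is isomorphic to the covering of the admissible quotient `kQ/I` defined by the weight
function `w`, for which `I` is homogeneous. -/
def IsCoveringOf (A : Type*) [Ring A] [Algebra k A] [Fintype V] [Fintype G]
    (I : TwoSidedIdeal (PathAlgebra k V)) : Prop :=
  IsAdmissible I ∧ IsWeightHomogeneousIdeal w I ∧
    Nonempty (A ≃ₐ[k] (liftIdeal w I).ringCon.Quotient)

end Covering

/-! ### Algebras given by generators and relations, and coverings of local algebras -/

/-- The algebra `k⟨X⟩ / ⟨R⟩`. -/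
abbrev Presented {k : Type*} [Field k] {X : Type*} (R : Set (FreeAlgebra k X)) : Type _ :=
  (TwoSidedIdeal.span R).ringCon.Quotient

/-- The vertex set (with exactly one element) of the quiver with set of loops `X`. -/
inductive Bouquet (X : Type v) : Type
  | pt

instance (X : Type v) : Fintype (Bouquet X) := ⟨{Bouquet.pt}, fun ⟨⟩ => Finset.mem_singleton_self _⟩

instance (X : Type v) : Quiver.{v} (Bouquet X) where
  Hom _ _ := X

/-- The loop `x`, as an element of the path algebra of the quiver with one vertex. -/
noncomputable def loop (k : Type*) [Field k] {X : Type v} (x : X) : PathAlgebra k (Bouquet X) :=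
  ofPath k (Quiver.Hom.toPath (show (Bouquet.pt : Bouquet X) ⟶ Bouquet.pt from x))

/-- The ideal of the path algebra of the quiver with one vertex and set of loops `X` that is
generated by relations written as non-commutative polynomials in the loops. -/
noncomputable def relationIdeal {k : Type*} [Field k] {X : Type v} (R : Set (FreeAlgebra k X)) :
    TwoSidedIdeal (PathAlgebra k (Bouquet X)) :=
  TwoSidedIdeal.span (FreeAlgebra.lift k (loop k) '' R)

/-- `A` is isomorphic to the covering of the local algebra `k⟨X⟩ / ⟨R⟩`, presented by the quiver
with one vertex and set of loops `X`, defined by the weight function `w`. -/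
def IsCoveringOfLocal {k : Type*} [Field k] {X : Type v} {G : Type*} [Group G] [Fintype G]
    (A : Type*) [Ring A] [Algebra k A] (R : Set (FreeAlgebra k X)) (w : X → G) : Prop :=
  IsLocalRing (Presented R) ∧
  (∃ φ : Presented R ≃ₐ[k] (relationIdeal R).ringCon.Quotient,
    ∀ x : X, φ ((TwoSidedIdeal.span R).ringCon.mk' (FreeAlgebra.ι k x)) =
      (relationIdeal R).ringCon.mk' (loop k x)) ∧
  IsCoveringOf (V := Bouquet X) (fun _ _ x => w x) A (relationIdeal R)

/-! ### The algebras -/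

/-- The three generators `x, y, z`. -/
inductive Gen3 : Type
  | x | y | z

/-- The two generators `y, z`. -/
inductive Gen2 : Type
  | y | z

section Relations

variable (k : Type*) [Field k] (p : ℕ)

local notation "X" => FreeAlgebra.ι k Gen3.x
local notation "Y" => FreeAlgebra.ι k Gen3.y
local notation "Z" => FreeAlgebra.ι k Gen3.z

/-- The relations of type B1. -/
def relB1 : Set (FreeAlgebra k Gen3) :=
  {(X * Y - Y * X) - Y, X * Z - Z * X, Y * Z - Z * Y, X ^ p - X, Y ^ p, Z ^ p}

/-- The relations of type C11. -/
def relC11 : Set (FreeAlgebra k Gen3) :=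
  {(X * Y - Y * X) - Y, X * Z - Z * X, Y * Z - Z * Y, X ^ p - X, Y ^ p, Z ^ p}

/-- The relations of type B3. -/
def relB3 : Set (FreeAlgebra k Gen3) :=
  {(X * Y - Y * X) - Y, (X * Z - Z * X) - Z, (Y * Z - Z * Y) - Y ^ 2, X ^ p - X, Y ^ p, Z ^ p}

/-- The relations of type C16, with parameters `c` (usually called `λ`) and `δ`. -/
def relC16 (c δ : k) : Set (FreeAlgebra k Gen3) :=
  {X * Y - Y * X, (X * Z - Z * X) - c • X, (Y * Z - Z * Y) - c⁻¹ • Y, X ^ p, Y ^ p,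
    Z ^ p - δ • Z}

local notation "y" => FreeAlgebra.ι k Gen2.y
local notation "z" => FreeAlgebra.ι k Gen2.z

/-- The relations of the local algebra `Λ₁`. -/
def relΛ₁ : Set (FreeAlgebra k Gen2) := {y ^ p, y * z - z * y, z ^ p}

/-- The relations of the local algebra `Λ₂`. -/
def relΛ₂ : Set (FreeAlgebra k Gen2) := {y ^ p, y * z - z * y - y ^ 2, z ^ p}

end Relations

/-- The weight function on `{y, z}` with the given values. -/
def weights {G : Type*} (wy wz : G) : Gen2 → G
  | Gen2.y => wy
  | Gen2.z => wz

end PathCovering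

/-! The character χ : σ^n ↦ n identifies G with the roots of X^p − X in k. In the covering of
k⟨X⟩/⟨R⟩ let e_g be the trivial path in the sheet g, put T = ∑ χ(g) e_g, and let f_x be the sum of
all arrows above the loop x. Then T^p = T, and T f_x = f_x (T + χ(w x)) because an arrow above x
leads from a sheet g to the sheet g·w(x). Moreover r(f) e_g is the lifting of r starting in the
sheet g, so r(f) = 0 in the covering for every homogeneous relation r.

Conversely, in any algebra with such T and f_x, the elements E_g = 1 − (T − χ(g))^(p−1) are complete
orthogonal idempotents with f_x E_h = E_{h·w(x)} f_x. Sending e_g to E_g and the arrow above x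
leaving the sheet g to f_x E_g gives a homomorphism from the covering. Hence the covering is
presented by T and the f_x, subject to R and to the relations above (`nonempty_algEquiv_covering`).

It remains to recognise T. In B1, C11 and B3 it is x. In C16 it is λ⁻¹z, while x and y play the
roles of the loops y and z: the commutators become T x = x (T − 1) and T y = y (T − λ⁻²), and z^p =
δz becomes T^p = T because λ^p = δλ. Since (λ⁻²)^(p−1) = δ⁻² = 1, the element λ⁻² lies in the prime
field, and a represents it.

The ideals are admissible because the quadratic relation rewrites each path as a combination of
monomials y^i z^j of the same degree, which vanish from degree 2p on; locality follows from
admissibility. -/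

namespace PathCovering

universe u v

/-! ### Homomorphisms out of quotients by generated ideals. -/

section Quotients

variable {k : Type*} [Field k] {A B : Type*} [Ring A] [Algebra k A] [Ring B] [Algebra k B]

/-- The algebra homomorphism on `A ⧸ ⟨S⟩` induced by one that vanishes on `S`. -/
noncomputable def quotientSpanLift (S : Set A) (f : A →ₐ[k] B) (hf : ∀ s ∈ S, f s = 0) :
    (TwoSidedIdeal.span S).ringCon.Quotient →ₐ[k] B :=
  RingCon.liftₐ _ f (TwoSidedIdeal.ringCon_le_iff.1
    (TwoSidedIdeal.span_le.2 fun s hs => (TwoSidedIdeal.mem_ker (f : A →+* B)).2 (hf s hs) :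
      TwoSidedIdeal.span S ≤ TwoSidedIdeal.ker (f : A →+* B)))

theorem quotientSpanLift_mk (S : Set A) (f : A →ₐ[k] B) (hf : ∀ s ∈ S, f s = 0) (x : A) :
    quotientSpanLift S f hf ((TwoSidedIdeal.span S).ringCon.mkₐ (α := k) x) = f x :=
  rfl

theorem mk_eq_zero_iff (I : TwoSidedIdeal A) (x : A) :
    I.ringCon.mkₐ (α := k) x = 0 ↔ x ∈ I :=
  Quotient.eq''

theorem mk_presented_eq_zero {X : Type*} {R : Set (FreeAlgebra k X)} {r : FreeAlgebra k X}
    (hr : r ∈ R) :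
    FreeAlgebra.lift k
      (fun x => (TwoSidedIdeal.span R).ringCon.mkₐ (α := k) (FreeAlgebra.ι k x)) r = 0 := by
  have : FreeAlgebra.lift k
      (fun x => (TwoSidedIdeal.span R).ringCon.mkₐ (α := k) (FreeAlgebra.ι k x)) =
      (TwoSidedIdeal.span R).ringCon.mkₐ (α := k) := by
    ext x
    simp
  rw [this, mk_eq_zero_iff]
  exact TwoSidedIdeal.subset_span hr

end Quotients

/-! ### Homomorphisms out of path algebras. -/

section Universal

variable {k : Type*} [Field k] {V : Type u} [Quiver.{v} V] {A : Type*} [Ring A] [Algebra k A]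

/-- The product of the images of the arrows of a path, the first arrow being rightmost. -/
def pathProd (f : ∀ ⦃a b : V⦄, (a ⟶ b) → A) {a : V} : ∀ {b : V}, Quiver.Path a b → A
  | _, Quiver.Path.nil => 1
  | _, Quiver.Path.cons p e => f e * pathProd f p

theorem pathProd_comp (f : ∀ ⦃a b : V⦄, (a ⟶ b) → A) {a b c : V} (p : Quiver.Path a b)
    (q : Quiver.Path b c) : pathProd f (p.comp q) = pathProd f q * pathProd f p := by
  induction q with
  | nil => simp [pathProd]
  | cons q e ih => simp [pathProd, ih, mul_assoc]

theorem pathProd_cast (f : ∀ ⦃a b : V⦄, (a ⟶ b) → A) {a b c d : V} (p : Quiver.Path a b)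
    (h : a = c) (h' : b = d) : pathProd f (p.cast h h') = pathProd f p := by
  subst h h'
  rfl

/-- The linear map on the path algebra with prescribed values on paths. -/
noncomputable def pathLinear (F : ∀ ⦃a b : V⦄, Quiver.Path a b → A) : PathAlgebra k V →ₗ[k] A :=
  (pathBasis k V).constr k fun q => F q.path

theorem pathLinear_ofPath (F : ∀ ⦃a b : V⦄, Quiver.Path a b → A) {a b : V}
    (q : Quiver.Path a b) : pathLinear F (ofPath k q) = F q := by
  simp [pathLinear, ofPath]

theorem pathAlgebra_linearMap_ext {M : Type*} [AddCommGroup M] [Module k M]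
    {f g : PathAlgebra k V →ₗ[k] M}
    (h : ∀ (a b : V) (q : Quiver.Path a b), f (ofPath k q) = g (ofPath k q)) : f = g :=
  (pathBasis k V).ext fun ⟨a, b, q⟩ => h a b q

/-- An algebra homomorphism on the path algebra is given by a multiplicative family of values on
the paths. -/
noncomputable def pathAlgHom [Fintype V] (F : ∀ ⦃a b : V⦄, Quiver.Path a b → A)
    (one : ∑ a : V, F (Quiver.Path.nil : Quiver.Path a a) = 1)
    (comp : ∀ (a b c : V) (q : Quiver.Path a b) (p : Quiver.Path b c), F (q.comp p) = F p * F q)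
    (zero : ∀ (a b c d : V) (q : Quiver.Path a b) (p : Quiver.Path c d), b ≠ c → F p * F q = 0) :
    PathAlgebra k V →ₐ[k] A :=
  AlgHom.ofLinearMap (pathLinear F)
    (by simp only [one_def, map_sum, pathLinear_ofPath, one])
    (by
      intro x y
      induction x using induction_on with
      | zero => simp
      | add x₁ x₂ h₁ h₂ => rw [add_mul, map_add, map_add, add_mul, h₁, h₂]
      | @path r c d p =>
        induction y using induction_on with
        | zero => simp
        | add x₁ x₂ h₁ h₂ => rw [mul_add, map_add, map_add, mul_add, h₁, h₂]
        | @path s a b q =>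
          simp only [smul_mul_assoc, mul_smul_comm, map_smul, pathLinear_ofPath]
          congr 2
          by_cases h : b = c
          · subst h
            rw [ofPath_mul_ofPath, pathLinear_ofPath, comp]
          · rw [ofPath_mul_ofPath_of_ne k _ _ h, map_zero, zero _ _ _ _ _ _ h])

theorem pathAlgHom_ofPath [Fintype V] (F : ∀ ⦃a b : V⦄, Quiver.Path a b → A) (one) (comp) (zero)
    {a b : V} (q : Quiver.Path a b) :
    pathAlgHom (k := k) F one comp zero (ofPath k q) = F q :=
  pathLinear_ofPath F q

end Universal

/-! ### The path algebra of a bouquet as a free algebra on its loops. -/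

section Bouquet

variable {k : Type*} [Field k] {X : Type v} {A : Type*} [Ring A] [Algebra k A]

instance : Subsingleton (Bouquet X) := ⟨fun ⟨⟩ ⟨⟩ => rfl⟩

/-- The algebra homomorphism on the path algebra of a bouquet with prescribed values on the
loops. -/
noncomputable def bouquetLift (k : Type*) [Field k] [Algebra k A] (f : X → A) :
    PathAlgebra k (Bouquet X) →ₐ[k] A :=
  pathAlgHom (V := Bouquet X) (fun _ _ p => pathProd (V := Bouquet X) (fun _ _ (x : X) => f x) p)
    (Fintype.sum_eq_single Bouquet.pt fun _ h => (h (Subsingleton.elim _ _)).elim)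
    (fun _ _ _ q p => pathProd_comp _ q p)
    (fun _ _ _ _ _ _ h => (h (Subsingleton.elim _ _)).elim)

theorem bouquetLift_ofPath (f : X → A) {a b : Bouquet X} (p : Quiver.Path a b) :
    bouquetLift k f (ofPath k p) = pathProd (V := Bouquet X) (fun _ _ (x : X) => f x) p :=
  pathAlgHom_ofPath _ _ _ _ p

theorem bouquetLift_loop (f : X → A) (x : X) : bouquetLift k f (loop k x) = f x := by
  rw [loop, bouquetLift_ofPath]
  exact mul_one _

theorem ofPath_nil (a : Bouquet X) : ofPath k (Quiver.Path.nil : Quiver.Path a a) = 1 := by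
  rw [one_def, Fintype.sum_eq_single a fun b h => (h (Subsingleton.elim _ _)).elim]

theorem ofPath_cons {a b c : Bouquet X} (p : Quiver.Path a b) (x : b ⟶ c) :
    ofPath k (p.cons x) = loop k (show X from x) * ofPath k p := by
  cases a; cases b; cases c
  rw [loop, ofPath_mul_ofPath]
  rfl

theorem bouquet_algHom_ext {f g : PathAlgebra k (Bouquet X) →ₐ[k] A}
    (h : ∀ x, f (loop k x) = g (loop k x)) : f = g := by
  refine AlgHom.toLinearMap_injective (pathAlgebra_linearMap_ext fun a b q => ?_)
  induction q with
  | nil => simp [ofPath_nil]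
  | cons q e ih =>
    rw [ofPath_cons]
    simp only [AlgHom.toLinearMap_apply, map_mul] at ih ⊢
    rw [ih, h]

theorem bouquetLift_freeAlgebra_lift_loop (f : X → A) (r : FreeAlgebra k X) :
    bouquetLift k f (FreeAlgebra.lift k (loop k) r) = FreeAlgebra.lift k f r := by
  have : (bouquetLift k f).comp (FreeAlgebra.lift k (loop k)) = FreeAlgebra.lift k f := by
    ext x
    simp [bouquetLift_loop]
  exact DFunLike.congr_fun this r

theorem bouquetLift_relation {R : Set (FreeAlgebra k X)} {f : X → A}
    (hR : ∀ r ∈ R, FreeAlgebra.lift k f r = 0) {s : PathAlgebra k (Bouquet X)}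
    (hs : s ∈ relationIdeal R) : bouquetLift k f s = 0 := by
  have : relationIdeal R ≤ TwoSidedIdeal.ker (bouquetLift k f : _ →+* A) := by
    rw [relationIdeal, TwoSidedIdeal.span_le]
    rintro _ ⟨r, hr, rfl⟩
    refine (TwoSidedIdeal.mem_ker _).2 ?_
    exact (bouquetLift_freeAlgebra_lift_loop f r).trans (hR r hr)
  exact (TwoSidedIdeal.mem_ker _).1 (this hs)

/-- The algebra `k⟨X⟩ / ⟨R⟩` as a quotient of the path algebra of the bouquet. -/
theorem exists_presented_algEquiv (R : Set (FreeAlgebra k X)) :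
    ∃ φ : Presented R ≃ₐ[k] (relationIdeal R).ringCon.Quotient,
      ∀ x : X, φ ((TwoSidedIdeal.span R).ringCon.mk' (FreeAlgebra.ι k x)) =
        (relationIdeal R).ringCon.mk' (loop k x) := by
  let F : Presented R →ₐ[k] (relationIdeal R).ringCon.Quotient :=
    quotientSpanLift R (((relationIdeal R).ringCon.mkₐ (α := k)).comp
      (FreeAlgebra.lift k (loop k))) fun r hr =>
        (mk_eq_zero_iff (k := k) _ _).2 (TwoSidedIdeal.subset_span ⟨r, hr, rfl⟩)
  let i : X → Presented R := fun x =>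
    (TwoSidedIdeal.span R).ringCon.mkₐ (α := k) (FreeAlgebra.ι k x)
  let H : (relationIdeal R).ringCon.Quotient →ₐ[k] Presented R :=
    quotientSpanLift _ (bouquetLift k i) fun s hs =>
      bouquetLift_relation (R := R) (fun r hr => mk_presented_eq_zero hr)
        (TwoSidedIdeal.subset_span hs)
  have hF : ∀ x, F (i x) = (relationIdeal R).ringCon.mkₐ (α := k) (loop k x) := fun x => by
    refine (quotientSpanLift_mk _ _ _ _).trans ?_
    simp
  have hH : ∀ x, H ((relationIdeal R).ringCon.mkₐ (α := k) (loop k x)) = i x := fun x =>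
    (quotientSpanLift_mk _ _ _ _).trans (bouquetLift_loop i x)
  refine ⟨AlgEquiv.ofAlgHom F H ?_ ?_, hF⟩
  · refine RingCon.Quotient.hom_extₐ (bouquet_algHom_ext fun x => ?_)
    exact (congrArg F (hH x)).trans (hF x)
  · refine RingCon.Quotient.hom_extₐ (FreeAlgebra.hom_ext (funext fun x => ?_))
    exact (congrArg H (hF x)).trans (hH x)

end Bouquet

/-! ### Spectral idempotents of an element T with T^p = T. -/

section Idempotents

open Polynomial

variable {k : Type*} [Field k] {p : ℕ} {G : Type*} {A : Type*} [Ring A] [Algebra k A]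

/-- An additive character of a group with `p` elements, identifying it with the set of roots of
`X ^ p - X`. -/
structure IsRootCharacter [Group G] [Fintype G] (p : ℕ) (χ : G → k) : Prop where
  one_lt : 1 < p
  card_eq : Fintype.card G = p
  map_mul : ∀ g h, χ (g * h) = χ g + χ h
  injective : Function.Injective χ
  pow_eq : ∀ g, χ g ^ p = χ g

/-- The idempotent projecting onto the eigenspace of `T` for the eigenvalue `χ g`. -/
def eigenIdempotent (p : ℕ) (χ : G → k) (T : A) (g : G) : A :=
  1 - (T - algebraMap k A (χ g)) ^ (p - 1)

theorem eigenIdempotent_eq_aeval (χ : G → k) (T : A) (g : G) :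
    eigenIdempotent p χ T g = aeval T (1 - (X - C (χ g)) ^ (p - 1) : k[X]) := by
  simp [eigenIdempotent]

namespace IsRootCharacter

variable [Group G] [Fintype G] {χ : G → k} {T : A}

/-- The remainder of P modulo X^p − X has degree below p and vanishes at the p distinct points χ g,
so it is zero. All identities between the eigenidempotents are thereby checked on values at these
points. -/
theorem aeval_eq_zero (hχ : IsRootCharacter p χ) (hT : T ^ p = T) (P : k[X])
    (hP : ∀ g, P.eval (χ g) = 0) : aeval T P = 0 := by
  have hp := hχ.one_lt
  have hmonic : (X ^ p - X : k[X]).Monic :=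
    monic_X_pow_sub (by simpa using hp)
  have hdeg : (X ^ p - X : k[X]).natDegree = p := FiniteField.X_pow_card_sub_X_natDegree_eq k hp
  have hdiv := modByMonic_add_div P (X ^ p - X)
  have hmod : P %ₘ (X ^ p - X) = 0 := by
    refine eq_zero_of_natDegree_lt_card_of_eval_eq_zero _ hχ.injective (fun g => ?_) ?_
    · have := congrArg (eval (χ g)) hdiv
      simpa [hχ.pow_eq, hP] using this
    · rw [hχ.card_eq]
      conv_rhs => rw [← hdeg]
      -- The degree bound needs a divisor other than 1, which holds because its degree is p > 1.
      exact natDegree_modByMonic_lt _ hmonic fun h => by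
        rw [h, natDegree_one] at hdeg
        omega
  rw [← hdiv, hmod]
  simp [hT]

/-- The difference equals χ(g h⁻¹), a nonzero root of X^p − X; one factor cancels. -/
theorem sub_pow_eq_one (hχ : IsRootCharacter p χ) {g h : G} (hgh : g ≠ h) :
    (χ g - χ h) ^ (p - 1) = 1 := by
  have hsub : χ g - χ h = χ (g * h⁻¹) := by
    rw [sub_eq_iff_eq_add, ← hχ.map_mul, inv_mul_cancel_right]
  have hne : χ g - χ h ≠ 0 := sub_ne_zero.2 (hχ.injective.ne hgh)
  refine mul_right_cancel₀ hne ?_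
  rw [← pow_succ, Nat.sub_add_cancel hχ.one_lt.le, one_mul, hsub, hχ.pow_eq]

theorem eval_eigenPolynomial [DecidableEq G] (hχ : IsRootCharacter p χ) (g h : G) :
    (1 - (X - C (χ g)) ^ (p - 1) : k[X]).eval (χ h) = if h = g then 1 else 0 := by
  split_ifs with hgh
  · subst hgh
    have : p - 1 ≠ 0 := by have := hχ.one_lt; omega
    simp [this]
  · simp [hχ.sub_pow_eq_one hgh]

theorem sum_eigenIdempotent (hχ : IsRootCharacter p χ) (hT : T ^ p = T) :
    ∑ g, eigenIdempotent p χ T g = 1 := by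
  classical
  have := hχ.aeval_eq_zero hT
    (∑ g, (1 - (X - C (χ g)) ^ (p - 1) : k[X]) - 1) fun h => by
      rw [eval_sub, eval_finsetSum]
      simp_rw [hχ.eval_eigenPolynomial]
      simp
  rw [map_sub, map_sum, map_one, sub_eq_zero] at this
  simpa only [eigenIdempotent_eq_aeval] using this

theorem eigenIdempotent_mul_self (hχ : IsRootCharacter p χ) (hT : T ^ p = T) (g : G) :
    eigenIdempotent p χ T g * eigenIdempotent p χ T g = eigenIdempotent p χ T g := by
  classical
  simp only [eigenIdempotent_eq_aeval]
  rw [← _root_.map_mul, ← sub_eq_zero, ← map_sub]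
  refine hχ.aeval_eq_zero hT _ fun h => ?_
  rw [eval_sub, eval_mul]
  simp_rw [hχ.eval_eigenPolynomial]
  split_ifs <;> simp

theorem eigenIdempotent_mul_of_ne (hχ : IsRootCharacter p χ) (hT : T ^ p = T) {g h : G}
    (hgh : g ≠ h) : eigenIdempotent p χ T g * eigenIdempotent p χ T h = 0 := by
  classical
  simp only [eigenIdempotent_eq_aeval]
  rw [← _root_.map_mul]
  refine hχ.aeval_eq_zero hT _ fun l => ?_
  rw [eval_mul]
  simp_rw [hχ.eval_eigenPolynomial]
  split_ifs with h₁ h₂ <;> simp_all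

theorem sum_smul_eigenIdempotent (hχ : IsRootCharacter p χ) (hT : T ^ p = T) :
    ∑ g, χ g • eigenIdempotent p χ T g = T := by
  classical
  have := hχ.aeval_eq_zero hT
    (∑ g, χ g • (1 - (X - C (χ g)) ^ (p - 1) : k[X]) - X) fun h => by
      rw [eval_sub, eval_finsetSum]
      simp_rw [eval_smul, hχ.eval_eigenPolynomial]
      simp
  rw [map_sub, map_sum, aeval_X, sub_eq_zero] at this
  simpa only [map_smul, eigenIdempotent_eq_aeval] using this

/-- The commutation rule says that x intertwines T − χ(h) with T − χ(hg), hence also their powers.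
So x carries the eigenspace of χ(h) into that of χ(hg), as an arrow changes sheets. -/
theorem mul_eigenIdempotent (hχ : IsRootCharacter p χ) {x : A} {g : G}
    (hx : T * x = x * (T + algebraMap k A (χ g))) (h : G) :
    x * eigenIdempotent p χ T h = eigenIdempotent p χ T (h * g) * x := by
  have : SemiconjBy x (T - algebraMap k A (χ h)) (T - algebraMap k A (χ (h * g))) := by
    rw [SemiconjBy, sub_mul, hx, hχ.map_mul, map_add, add_mul, mul_sub, mul_add,
      Algebra.commutes (χ h), Algebra.commutes (χ g)]
    abel
  rw [eigenIdempotent, eigenIdempotent, mul_sub, sub_mul, (this.pow_right (p - 1)).eq, mul_one,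
    one_mul]

end IsRootCharacter

end Idempotents

/-! ### The elements T and f_x inside the path algebra of the covering quiver. -/

section CoveringQuiver

open Polynomial

variable {k : Type*} [Field k] {X : Type v} {G : Type*} [Group G] (w : X → G)

/-- The covering quiver of the bouquet with set of loops `X`. -/
abbrev BouquetCover : Type _ := CoverVertex (V := Bouquet X) (G := G) fun _ _ (x : X) => w x

/-- The vertex of the covering quiver in the sheet `g`. -/
abbrev coverPt (g : G) : BouquetCover w := ⟨Bouquet.pt, g⟩

variable {w} in
/-- The loop below an arrow of the covering quiver. -/
def underLoop {s t : BouquetCover w} (e : s ⟶ t) : X := Subtype.val e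

/-- The trivial path of the covering quiver in the sheet `g`. -/
noncomputable def coverIdem (k : Type*) [Field k] (g : G) : PathAlgebra k (BouquetCover w) :=
  ofPath k (Quiver.Path.nil : Quiver.Path (coverPt w g) (coverPt w g))

/-- The arrow of the covering quiver over the loop `x`, with origin in the sheet `g`. -/
noncomputable def coverArrow (k : Type*) [Field k] (x : X) (g : G) :
    PathAlgebra k (BouquetCover w) :=
  ofPath k (Quiver.Hom.toPath
    (show coverPt w g ⟶ coverPt w (g * w x) from ⟨x, rfl⟩))

variable {w}

theorem ofPath_mul_coverIdem {s t : BouquetCover w} (q : Quiver.Path s t) :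
    ofPath k q * coverIdem w k s.sheet = ofPath k q := by
  obtain ⟨⟨⟩, g⟩ := s
  rw [coverIdem, ofPath_mul_ofPath, Quiver.Path.nil_comp]

theorem ofPath_mul_coverIdem_of_ne {s t : BouquetCover w} (q : Quiver.Path s t) {g : G}
    (h : g ≠ s.sheet) : ofPath k q * coverIdem w k g = 0 :=
  ofPath_mul_ofPath_of_ne k _ _ fun h' => h (congrArg CoverVertex.sheet h')

theorem pathProd_liftPath {A : Type*} [Ring A] (f : X → A) (g : G) {a b : Bouquet X}
    (q : Quiver.Path a b) :
    pathProd (V := BouquetCover w) (fun _ _ e => f (underLoop e)) (liftPath (fun _ _ (x : X) => w x) g q) =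
      pathProd (V := Bouquet X) (fun _ _ (x : X) => f x) q := by
  induction q with
  | nil => exact pathProd_cast (V := BouquetCover w) _ _ _ _
  | cons q e ih => exact congrArg (f e * ·) ih

variable (w) [Fintype G]

/-- The sum of all arrows of the covering quiver over the loop `x`. -/
noncomputable def coverLoop (k : Type*) [Field k] (x : X) : PathAlgebra k (BouquetCover w) :=
  ∑ g, coverArrow w k x g

theorem sum_coverIdem : ∑ g, coverIdem w k g = 1 := by
  rw [one_def]
  refine Fintype.sum_equiv ⟨fun g => coverPt w g, fun s => s.sheet, fun _ => rfl, fun ⟨⟨⟩, _⟩ => rfl⟩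
    _ _ fun _ => rfl

variable {w}

theorem eq_of_mul_coverIdem_eq {x y : PathAlgebra k (BouquetCover w)}
    (h : ∀ g, x * coverIdem w k g = y * coverIdem w k g) : x = y := by
  rw [← mul_one x, ← mul_one y, ← sum_coverIdem, Finset.mul_sum, Finset.mul_sum]
  exact Finset.sum_congr rfl fun g _ => h g

theorem coverLoop_mul_coverIdem (x : X) (g : G) :
    coverLoop w k x * coverIdem w k g = coverArrow w k x g := by
  rw [coverLoop, Finset.sum_mul, Fintype.sum_eq_single g fun h hh => ?_]
  · exact ofPath_mul_coverIdem _
  · exact ofPath_mul_coverIdem_of_ne _ hh.symm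

/-- Only one arrow above x starts where q ends. The end sheet `l` is a variable so that the equation
`hx` can be substituted away. -/
theorem coverLoop_mul_ofPath_coverPt {s : BouquetCover w} {h l : G} {x : X} (hx : h * w x = l)
    (q : Quiver.Path s (coverPt w h)) :
    coverLoop w k x * ofPath k q =
      ofPath k (q.cons (show coverPt w h ⟶ coverPt w l from ⟨x, hx⟩)) := by
  subst hx
  have hq : ofPath k q = coverIdem w k h * ofPath k q := by
    rw [coverIdem, ofPath_mul_ofPath, Quiver.Path.comp_nil]
  rw [hq, ← mul_assoc, coverLoop_mul_coverIdem, coverArrow, ofPath_mul_ofPath]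
  rfl

theorem coverLoop_mul_ofPath {s : BouquetCover w} :
    ∀ {t t' : BouquetCover w} (q : Quiver.Path s t) (e : t ⟶ t'),
      coverLoop w k (underLoop e) * ofPath k q = ofPath k (q.cons e)
  | ⟨Bouquet.pt, _⟩, ⟨Bouquet.pt, _⟩, q, ⟨_, hx⟩ =>
    coverLoop_mul_ofPath_coverPt hx q

/-- Once the starting sheet is fixed by the idempotent, each factor `coverLoop` contributes exactly
the arrow continuing the path. Every path is thus a polynomial expression in the f_x and the trivial
paths. -/
theorem pathProd_coverLoop_mul_coverIdem {s t : BouquetCover w} (q : Quiver.Path s t) :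
    pathProd (V := BouquetCover w) (fun _ _ e => coverLoop w k (underLoop e)) q *
      coverIdem w k s.sheet = ofPath k q := by
  induction q with
  | nil =>
    obtain ⟨⟨⟩, g⟩ := s
    exact one_mul _
  | cons q e ih => rw [pathProd, mul_assoc, ih, coverLoop_mul_ofPath]

/-- This turns lifting into substitution: evaluate at the f_x, then cut down to the starting sheet
g. -/
theorem bouquetLift_coverLoop_mul_coverIdem (s : PathAlgebra k (Bouquet X)) (g : G) :
    bouquetLift k (coverLoop w k) s * coverIdem w k g =
      lift k (fun _ _ (x : X) => w x) g s := by
  induction s using induction_on with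
  | zero => simp
  | add x y hx hy => rw [map_add, map_add, add_mul, hx, hy]
  | path r q =>
    rename_i a b
    cases a
    rw [map_smul, map_smul, smul_mul_assoc, bouquetLift_ofPath,
      ← pathProd_liftPath (w := w) (coverLoop w k) g q]
    congr 1
    refine (pathProd_coverLoop_mul_coverIdem (w := w) _).trans ?_
    simp [lift, ofPath]

/-- Since 1 = ∑ e_g, the evaluation of s is the sum of its liftings, each of which generates part of
the lifted ideal when s is homogeneous. -/
theorem bouquetLift_coverLoop_mem {I : TwoSidedIdeal (PathAlgebra k (Bouquet X))}
    {s : PathAlgebra k (Bouquet X)} (hs : s ∈ I) {h : G}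
    (hom : IsWeightHomogeneous (fun _ _ (x : X) => w x) h s) :
    bouquetLift k (coverLoop w k) s ∈ liftIdeal (fun _ _ (x : X) => w x) I := by
  rw [← mul_one (bouquetLift k (coverLoop w k) s), ← sum_coverIdem, Finset.mul_sum]
  refine sum_mem fun g _ => TwoSidedIdeal.subset_span ⟨g, h, s, hs, hom, ?_⟩
  exact bouquetLift_coverLoop_mul_coverIdem s g

/-- The element of the path algebra of the covering quiver acting on the sheet `g` as `χ g`. -/
noncomputable def coverEigen (w : X → G) (χ : G → k) : PathAlgebra k (BouquetCover w) :=
  ∑ g, χ g • coverIdem w k g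

theorem coverEigen_mul_ofPath (χ : G → k) {s t : BouquetCover w} (q : Quiver.Path s t) :
    coverEigen w χ * ofPath k q = χ t.sheet • ofPath k q := by
  obtain ⟨⟨⟩, h⟩ := t
  rw [coverEigen, Finset.sum_mul, Fintype.sum_eq_single h fun g hg => ?_]
  · rw [smul_mul_assoc, coverIdem, ofPath_mul_ofPath, Quiver.Path.comp_nil]
  · rw [smul_mul_assoc, coverIdem, ofPath_mul_ofPath_of_ne, smul_zero]
    exact fun h' => hg (congrArg CoverVertex.sheet h').symm

theorem coverEigen_pow_mul_coverIdem (χ : G → k) (n : ℕ) (g : G) :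
    coverEigen w χ ^ n * coverIdem w k g = χ g ^ n • coverIdem w k g := by
  induction n with
  | zero => simp
  | succ n ih =>
    have h1 : coverEigen w χ * coverIdem w k g = χ g • coverIdem w k g :=
      coverEigen_mul_ofPath χ _
    rw [pow_succ, mul_assoc, h1, mul_smul_comm, ih, smul_smul, pow_succ']

theorem aeval_coverEigen_mul_coverIdem (χ : G → k) (P : Polynomial k) (g : G) :
    aeval (coverEigen w χ) P * coverIdem w k g = P.eval (χ g) • coverIdem w k g := by
  induction P using Polynomial.induction_on' with
  | add P Q hP hQ => rw [map_add, add_mul, hP, hQ, eval_add, add_smul]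
  | monomial n a =>
    rw [aeval_monomial, mul_assoc, coverEigen_pow_mul_coverIdem, eval_monomial,
      ← Algebra.smul_def, smul_smul]

namespace IsRootCharacter

variable {p : ℕ} {χ : G → k}

theorem coverEigen_pow (hχ : IsRootCharacter p χ) : coverEigen w χ ^ p = coverEigen w χ :=
  eq_of_mul_coverIdem_eq fun g => by
    rw [coverEigen_pow_mul_coverIdem, hχ.pow_eq]
    exact (coverEigen_mul_ofPath χ _).symm

theorem coverEigen_mul_coverLoop (hχ : IsRootCharacter p χ) (x : X) :
    coverEigen w χ * coverLoop w k x =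
      coverLoop w k x * (coverEigen w χ + algebraMap k _ (χ (w x))) := by
  refine eq_of_mul_coverIdem_eq fun g => ?_
  have h1 : coverEigen w χ * coverIdem w k g = χ g • coverIdem w k g :=
    coverEigen_mul_ofPath χ _
  rw [mul_assoc, coverLoop_mul_coverIdem, mul_assoc, add_mul, h1, ← Algebra.smul_def, ← add_smul,
    mul_smul_comm, coverLoop_mul_coverIdem, ← hχ.map_mul]
  exact coverEigen_mul_ofPath χ _

/-- The trivial paths are polynomials in T; hence a homomorphism that controls T and the f_x
controls all paths. -/
theorem eigenIdempotent_coverEigen (hχ : IsRootCharacter p χ) (g : G) :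
    eigenIdempotent p χ (coverEigen w χ) g = coverIdem w k g := by
  classical
  refine eq_of_mul_coverIdem_eq fun h => ?_
  rw [eigenIdempotent_eq_aeval, aeval_coverEigen_mul_coverIdem, hχ.eval_eigenPolynomial]
  split_ifs with hgh
  · subst hgh
    rw [one_smul]
    exact (ofPath_mul_coverIdem _).symm
  · rw [zero_smul]
    exact (ofPath_mul_coverIdem_of_ne _ hgh).symm

end IsRootCharacter

end CoveringQuiver

/-! ### The covering is presented by T, the f_x and their relations. -/

section CoveringIso

variable {k : Type*} [Field k] {X : Type v} {G : Type*} [Group G] [Fintype G] {w : X → G}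
  {p : ℕ} {χ : G → k} {A : Type*} [Ring A] [Algebra k A]

theorem pathProd_mul_eigenIdempotent (hχ : IsRootCharacter p χ) {T : A} {f : X → A}
    (hf : ∀ x, T * f x = f x * (T + algebraMap k A (χ (w x)))) {s t : BouquetCover w}
    (q : Quiver.Path s t) :
    pathProd (V := BouquetCover w) (fun _ _ e => f (underLoop e)) q *
        eigenIdempotent p χ T s.sheet =
      eigenIdempotent p χ T t.sheet *
        pathProd (V := BouquetCover w) (fun _ _ e => f (underLoop e)) q := by
  induction q with
  | nil => exact (one_mul _).trans (mul_one _).symm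
  | cons q e ih =>
    rw [pathProd, mul_assoc, ih, ← mul_assoc, hχ.mul_eigenIdempotent (hf _), mul_assoc]
    congr 2
    exact e.2

/-- The homomorphism from the path algebra of the covering quiver to an algebra with an element
`T` whose eigenspaces are permuted by the images of the loops. -/
noncomputable def coverAlgHom (hχ : IsRootCharacter p χ) {T : A} (hT : T ^ p = T) {f : X → A}
    (hf : ∀ x, T * f x = f x * (T + algebraMap k A (χ (w x)))) :
    PathAlgebra k (BouquetCover w) →ₐ[k] A :=
  pathAlgHom (V := BouquetCover w)
    (fun s _ q => pathProd (V := BouquetCover w) (fun _ _ e => f (underLoop e)) q *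
      eigenIdempotent p χ T s.sheet)
    (by
      rw [← hχ.sum_eigenIdempotent hT]
      exact Fintype.sum_equiv
        ⟨fun s => s.sheet, fun g => coverPt w g, fun ⟨⟨⟩, _⟩ => rfl, fun _ => rfl⟩ _ _
        fun _ => one_mul _)
    (fun a b c q r => by
      rw [pathProd_comp, mul_assoc, mul_assoc (pathProd _ r) (eigenIdempotent p χ T b.sheet),
        ← mul_assoc (eigenIdempotent p χ T b.sheet),
        ← pathProd_mul_eigenIdempotent hχ hf, mul_assoc (pathProd _ q),
        hχ.eigenIdempotent_mul_self hT])
    (fun a b c d q r h => by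
      have h' : c.sheet ≠ b.sheet := fun h' => h (by
        cases b with | mk vb gb => cases c with | mk vc gc => cases vb; cases vc; simp_all)
      rw [mul_assoc, pathProd_mul_eigenIdempotent hχ hf q,
        ← mul_assoc (eigenIdempotent p χ T c.sheet), hχ.eigenIdempotent_mul_of_ne hT h', zero_mul,
        mul_zero])

theorem coverAlgHom_ofPath (hχ : IsRootCharacter p χ) {T : A} (hT : T ^ p = T) {f : X → A}
    (hf : ∀ x, T * f x = f x * (T + algebraMap k A (χ (w x)))) {s t : BouquetCover w}
    (q : Quiver.Path s t) :
    coverAlgHom hχ hT hf (ofPath k q) =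
      pathProd (V := BouquetCover w) (fun _ _ e => f (underLoop e)) q *
        eigenIdempotent p χ T s.sheet :=
  pathAlgHom_ofPath _ _ _ _ q

theorem coverAlgHom_lift (hχ : IsRootCharacter p χ) {T : A} (hT : T ^ p = T) {f : X → A}
    (hf : ∀ x, T * f x = f x * (T + algebraMap k A (χ (w x)))) (g : G)
    (s : PathAlgebra k (Bouquet X)) :
    coverAlgHom hχ hT hf (lift k (fun _ _ (x : X) => w x) g s) =
      bouquetLift k f s * eigenIdempotent p χ T g := by
  induction s using induction_on with
  | zero => simp
  | add x y hx hy => rw [map_add, map_add, map_add, add_mul, hx, hy]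
  | path r q =>
    simp only [map_smul, smul_mul_assoc]
    congr 1
    rw [bouquetLift_ofPath, ← pathProd_liftPath (w := w) f g q]
    refine Eq.trans ?_ (coverAlgHom_ofPath hχ hT hf _)
    simp [lift, ofPath]

theorem coverAlgHom_coverEigen (hχ : IsRootCharacter p χ) {T : A} (hT : T ^ p = T) {f : X → A}
    (hf : ∀ x, T * f x = f x * (T + algebraMap k A (χ (w x)))) :
    coverAlgHom hχ hT hf (coverEigen w χ) = T := by
  conv_rhs => rw [← hχ.sum_smul_eigenIdempotent hT]
  rw [coverEigen, map_sum]
  refine Finset.sum_congr rfl fun g _ => ?_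
  rw [map_smul, coverIdem, coverAlgHom_ofPath]
  exact congrArg _ (one_mul _)

theorem coverAlgHom_coverLoop (hχ : IsRootCharacter p χ) {T : A} (hT : T ^ p = T) {f : X → A}
    (hf : ∀ x, T * f x = f x * (T + algebraMap k A (χ (w x)))) (x : X) :
    coverAlgHom hχ hT hf (coverLoop w k x) = f x := by
  rw [← mul_one (f x), ← hχ.sum_eigenIdempotent hT, coverLoop, map_sum, Finset.mul_sum]
  refine Finset.sum_congr rfl fun g _ => ?_
  rw [coverArrow, coverAlgHom_ofPath]
  exact congrArg (· * _) (mul_one _)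

/-- An algebra generated by an element `T` with `T ^ p = T` and by elements `f x` for the loops `x`,
subject only to the relations `R` and to `T * f x = f x * (T + χ (w x))`, is the covering of
`k⟨X⟩ / ⟨R⟩` with weight function `w`. -/
theorem nonempty_algEquiv_covering (hχ : IsRootCharacter p χ) {R : Set (FreeAlgebra k X)}
    (hom : ∀ r ∈ R, ∃ g : G, IsWeightHomogeneous (fun _ _ (x : X) => w x) g
      (FreeAlgebra.lift k (loop k) r))
    {T : A} (hT : T ^ p = T) {f : X → A}
    (hf : ∀ x, T * f x = f x * (T + algebraMap k A (χ (w x))))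
    (hR : ∀ r ∈ R, FreeAlgebra.lift k f r = 0)
    (exists_hom : ∀ (T' : (liftIdeal (fun _ _ (x : X) => w x) (relationIdeal R)).ringCon.Quotient)
      (f' : X → (liftIdeal (fun _ _ (x : X) => w x) (relationIdeal R)).ringCon.Quotient),
      T' ^ p = T' → (∀ x, T' * f' x = f' x * (T' + algebraMap k _ (χ (w x)))) →
      (∀ r ∈ R, FreeAlgebra.lift k f' r = 0) →
      ∃ φ : A →ₐ[k] (liftIdeal (fun _ _ (x : X) => w x) (relationIdeal R)).ringCon.Quotient,
        φ T = T' ∧ ∀ x, φ (f x) = f' x)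
    (hom_ext : ∀ h : A →ₐ[k] A, h T = T → (∀ x, h (f x) = f x) → h = AlgHom.id k A) :
    Nonempty (A ≃ₐ[k]
      (liftIdeal (fun _ _ (x : X) => w x) (relationIdeal R)).ringCon.Quotient) := by
  let π := (liftIdeal (fun _ _ (x : X) => w x) (relationIdeal R)).ringCon.mkₐ (α := k)
  -- Of the universal property of A, only maps to the covering are needed, and only for the T and
  -- f_x found there.
  obtain ⟨φ, hφT, hφf⟩ := exists_hom (π (coverEigen w χ)) (fun x => π (coverLoop w k x))
    (by rw [← map_pow, hχ.coverEigen_pow])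
    (fun x => by rw [← map_mul, hχ.coverEigen_mul_coverLoop, map_mul, map_add, AlgHom.commutes])
    (fun r hr => by
      obtain ⟨g, hg⟩ := hom r hr
      have h1 : FreeAlgebra.lift k (fun x => π (coverLoop w k x)) =
          (π.comp (bouquetLift k (coverLoop w k))).comp (FreeAlgebra.lift k (loop k)) := by
        ext x
        simp [bouquetLift_loop]
      rw [h1]
      exact (mk_eq_zero_iff (k := k) _ _).2
        (bouquetLift_coverLoop_mem (TwoSidedIdeal.subset_span ⟨r, hr, rfl⟩) hg))
  -- The inverse is well defined: a lifting of r in the sheet g goes to r(f) E_g, and r(f) = 0.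
  let ψ : (liftIdeal (fun _ _ (x : X) => w x) (relationIdeal R)).ringCon.Quotient →ₐ[k] A :=
    quotientSpanLift _ (coverAlgHom hχ hT hf) (by
      rintro _ ⟨g, h, r, hr, -, rfl⟩
      rw [coverAlgHom_lift, bouquetLift_relation hR hr, zero_mul])
  have hψ : ∀ y, ψ (π y) = coverAlgHom hχ hT hf y := fun y => quotientSpanLift_mk _ _ _ _
  refine ⟨AlgEquiv.ofAlgHom φ ψ ?_ (hom_ext _ ?_ fun x => ?_)⟩
  -- It suffices to compare on paths, and a path is the product of the f_x of its arrows times the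
  -- idempotent of its source.
  · refine RingCon.Quotient.hom_extₐ (AlgHom.toLinearMap_injective
      (pathAlgebra_linearMap_ext fun s t q => ?_))
    change φ (ψ (π (ofPath k q))) = π (ofPath k q)
    rw [hψ, coverAlgHom_ofPath, map_mul]
    have h1 : φ (eigenIdempotent p χ T s.sheet) = π (coverIdem w k s.sheet) := by
      rw [← hχ.eigenIdempotent_coverEigen]
      simp [eigenIdempotent, hφT]
    have h2 : φ (pathProd (V := BouquetCover w) (fun _ _ e => f (underLoop e)) q) =
        π (pathProd (V := BouquetCover w) (fun _ _ e => coverLoop w k (underLoop e)) q) := by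
      induction q with
      | nil => simp [pathProd]
      | cons q e ih => rw [pathProd, pathProd, map_mul, map_mul, ih, hφf]
    rw [h1, h2, ← map_mul, pathProd_coverLoop_mul_coverIdem]
  · rw [AlgHom.comp_apply, hφT, hψ, coverAlgHom_coverEigen]
  · rw [AlgHom.comp_apply, hφf, hψ, coverAlgHom_coverLoop]

end CoveringIso

/-! ### Powers of the arrow ideal. -/

section ArrowIdeal

variable {k : Type*} [Field k] {V : Type u} [Quiver.{v} V]

theorem ofPath_mem_arrowIdeal {a b : V} (q : Quiver.Path a b) (hq : 1 ≤ q.length) :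
    ofPath k q ∈ arrowIdeal k V :=
  Submodule.subset_span ⟨a, b, q, hq, rfl⟩

theorem loop_mem_arrowIdeal {X : Type v} (x : X) : loop k x ∈ arrowIdeal k (Bouquet X) :=
  ofPath_mem_arrowIdeal _ le_rfl

variable [Fintype V]

theorem mul_mem_arrowIdeal_left (x : PathAlgebra k V) {y : PathAlgebra k V}
    (hy : y ∈ arrowIdeal k V) : x * y ∈ arrowIdeal k V := by
  induction hy using Submodule.span_induction with
  | zero => simp
  | add y₁ y₂ _ _ h₁ h₂ => rw [mul_add]; exact add_mem h₁ h₂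
  | smul r y _ h => rw [mul_smul_comm]; exact Submodule.smul_mem _ _ h
  | mem y hy =>
    obtain ⟨c, d, q, hq, rfl⟩ := hy
    induction x using induction_on with
    | zero => simp
    | add x₁ x₂ h₁ h₂ => rw [add_mul]; exact add_mem h₁ h₂
    | @path r a b l =>
      rw [smul_mul_assoc]
      refine Submodule.smul_mem _ _ ?_
      by_cases h : d = a
      · subst h
        rw [ofPath_mul_ofPath]
        exact ofPath_mem_arrowIdeal _ (by rw [Quiver.Path.length_comp]; omega)
      · rw [ofPath_mul_ofPath_of_ne k _ _ h]
        exact zero_mem _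

theorem mul_mem_arrowIdeal_right {x : PathAlgebra k V} (hx : x ∈ arrowIdeal k V)
    (y : PathAlgebra k V) : x * y ∈ arrowIdeal k V := by
  induction hx using Submodule.span_induction with
  | zero => simp
  | add y₁ y₂ _ _ h₁ h₂ => rw [add_mul]; exact add_mem h₁ h₂
  | smul r y _ h => rw [smul_mul_assoc]; exact Submodule.smul_mem _ _ h
  | mem x hx =>
    obtain ⟨c, d, q, hq, rfl⟩ := hx
    induction y using induction_on with
    | zero => simp
    | add x₁ x₂ h₁ h₂ => rw [mul_add]; exact add_mem h₁ h₂
    | @path r a b l =>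
      rw [mul_smul_comm]
      refine Submodule.smul_mem _ _ ?_
      by_cases h : b = c
      · subst h
        rw [ofPath_mul_ofPath]
        exact ofPath_mem_arrowIdeal _ (by rw [Quiver.Path.length_comp]; omega)
      · rw [ofPath_mul_ofPath_of_ne k _ _ h]
        exact zero_mem _

theorem arrowIdeal_sq_le : arrowIdeal k V ^ 2 ≤ arrowIdeal k V := by
  rw [pow_two]
  exact Submodule.mul_le.2 fun x _ _ hy => mul_mem_arrowIdeal_left x hy

/-- The square of the arrow ideal, as a two-sided ideal. -/
noncomputable def arrowIdealSq (k : Type*) [Field k] (V : Type u) [Quiver.{v} V] [Fintype V] :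
    TwoSidedIdeal (PathAlgebra k V) :=
  TwoSidedIdeal.mk' (arrowIdeal k V ^ 2 : Submodule k (PathAlgebra k V)) (zero_mem _)
    (fun hx hy => add_mem hx hy) (fun hx => neg_mem hx)
    (fun {x y} hy => by
      rw [SetLike.mem_coe, pow_two] at hy ⊢
      induction hy using Submodule.mul_induction_on' with
      | mem_mul_mem m hm n hn =>
        rw [← mul_assoc]
        exact Submodule.mul_mem_mul (mul_mem_arrowIdeal_left x hm) hn
      | add y₁ _ y₂ _ h₁ h₂ => rw [mul_add]; exact add_mem h₁ h₂)
    (fun {x y} hx => by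
      rw [SetLike.mem_coe, pow_two] at hx ⊢
      induction hx using Submodule.mul_induction_on' with
      | mem_mul_mem m hm n hn =>
        rw [mul_assoc]
        exact Submodule.mul_mem_mul hm (mul_mem_arrowIdeal_right hn y)
      | add y₁ _ y₂ _ h₁ h₂ => rw [add_mul]; exact add_mem h₁ h₂)

theorem mem_arrowIdealSq {x : PathAlgebra k V} :
    x ∈ arrowIdealSq k V ↔ x ∈ arrowIdeal k V ^ 2 :=
  TwoSidedIdeal.mem_mk' ..

theorem arrowIdeal_pow_le_span (n : ℕ) :
    arrowIdeal k V ^ n ≤ Submodule.span k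
      {x | ∃ (a b : V) (q : Quiver.Path a b), n ≤ q.length ∧ x = ofPath k q} := by
  induction n with
  | zero =>
    -- The zeroth power is the line k·1, and 1 is the sum of the trivial paths.
    rw [pow_zero, Submodule.one_le, one_def]
    exact sum_mem fun a _ => Submodule.subset_span ⟨a, a, _, le_rfl, rfl⟩
  | succ n ih =>
    rw [pow_succ]
    refine (mul_le_mul' ih le_rfl).trans ?_
    rw [arrowIdeal, Submodule.span_mul_span, Submodule.span_le]
    rintro _ ⟨_, ⟨a, b, q, hq, rfl⟩, _, ⟨c, d, l, hl, rfl⟩, rfl⟩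
    change ofPath k q * ofPath k l ∈ _
    by_cases h : d = a
    · subst h
      rw [ofPath_mul_ofPath]
      exact Submodule.subset_span
        ⟨_, _, _, by rw [Quiver.Path.length_comp]; omega, rfl⟩
    · rw [ofPath_mul_ofPath_of_ne k _ _ h]
      exact zero_mem _

end ArrowIdeal

/-! ### Admissible quotients of a bouquet are local. -/

section LocalRing

variable {k : Type*} [Field k] {X : Type v}

theorem bouquetLift_zero_of_mem_arrowIdeal {x : PathAlgebra k (Bouquet X)}
    (hx : x ∈ arrowIdeal k (Bouquet X)) : bouquetLift k (0 : X → k) x = 0 := by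
  induction hx using Submodule.span_induction with
  | zero => simp
  | add y₁ y₂ _ _ h₁ h₂ => rw [map_add, h₁, h₂, add_zero]
  | smul r y _ h => rw [map_smul, h, smul_zero]
  | mem x hx =>
    obtain ⟨a, b, q, hq, rfl⟩ := hx
    rw [bouquetLift_ofPath]
    cases q with
    | nil => simp at hq
    | cons q e => exact zero_mul _

theorem sub_algebraMap_mem_arrowIdeal (x : PathAlgebra k (Bouquet X)) :
    x - algebraMap k _ (bouquetLift k (0 : X → k) x) ∈ arrowIdeal k (Bouquet X) := by
  induction x using induction_on with
  | zero => simp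
  | add x y hx hy =>
    rw [map_add, map_add, add_sub_add_comm]
    exact add_mem hx hy
  | @path r a b q =>
    rw [map_smul, smul_eq_mul, map_mul, ← Algebra.smul_def, ← smul_sub]
    refine Submodule.smul_mem _ _ ?_
    cases q with
    | nil => simp [ofPath_nil]
    | cons q e =>
      have h : ofPath k (q.cons e) ∈ arrowIdeal k (Bouquet X) :=
        ofPath_mem_arrowIdeal _ (Nat.succ_le_succ (Nat.zero_le _))
      rw [bouquetLift_zero_of_mem_arrowIdeal h, map_zero, sub_zero]
      exact h

/-- The augmentation killing all loops vanishes on I because I ⊆ J² ⊆ J. An element of nonzero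
augmentation is a nonzero scalar plus an element of J, which is nilpotent modulo I, hence it is a
unit. If two elements add up to 1, one of them has nonzero augmentation. -/
theorem isLocalRing_of_isAdmissible {I : TwoSidedIdeal (PathAlgebra k (Bouquet X))}
    (hI : IsAdmissible I) : IsLocalRing I.ringCon.Quotient := by
  obtain ⟨⟨m, -, hm⟩, hI2⟩ := hI
  let π := I.ringCon.mkₐ (α := k)
  have haug : ∀ x ∈ I, bouquetLift k (0 : X → k) x = 0 := fun x hx =>
    bouquetLift_zero_of_mem_arrowIdeal (arrowIdeal_sq_le (hI2 x hx))
  have hunit : ∀ x, bouquetLift k (0 : X → k) x ≠ 0 → IsUnit (π x) := fun x hx => by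
    have hnil : IsNilpotent (π (x - algebraMap k _ (bouquetLift k (0 : X → k) x))) := by
      refine ⟨m, ?_⟩
      rw [← map_pow]
      exact (mk_eq_zero_iff (k := k) _ _).2
        (hm _ (Submodule.pow_mem_pow _ (sub_algebraMap_mem_arrowIdeal x) m))
    have h := hnil.isUnit_add_left_of_commute (u := π (algebraMap k _ (bouquetLift k (0 : X → k) x)))
      (by rw [AlgHom.commutes]; exact (isUnit_iff_ne_zero.2 hx).map (algebraMap k _))
      (by rw [AlgHom.commutes]; exact (Algebra.commutes _ _).symm)
    rwa [← map_add, add_sub_cancel] at h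
  have : Nontrivial I.ringCon.Quotient := by
    refine ⟨1, 0, fun h => ?_⟩
    have := haug 1 ((mk_eq_zero_iff (k := k) I 1).1 ((map_one π).trans h))
    rw [map_one] at this
    exact one_ne_zero this
  refine ⟨fun {a b} hab => ?_⟩
  obtain ⟨x, rfl⟩ := I.ringCon.mkₐ_surjective (α := k) a
  obtain ⟨y, rfl⟩ := I.ringCon.mkₐ_surjective (α := k) b
  have hxy : bouquetLift k (0 : X → k) x + bouquetLift k (0 : X → k) y = 1 := by
    have h := haug (x + y - 1) ((mk_eq_zero_iff (k := k) I _).1 (by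
      rw [map_sub, map_add, hab, map_one, sub_self]))
    rwa [map_sub, map_add, map_one, sub_eq_zero] at h
  by_cases hx : bouquetLift k (0 : X → k) x = 0
  · refine Or.inr (hunit y fun hy => ?_)
    simp [hx, hy] at hxy
  · exact Or.inl (hunit x hx)

theorem isLocalRing_presented {R : Set (FreeAlgebra k X)} (hI : IsAdmissible (relationIdeal R)) :
    IsLocalRing (Presented R) := by
  obtain ⟨φ, -⟩ := exists_presented_algEquiv R
  have h := isLocalRing_of_isAdmissible hI
  have : Nontrivial (Presented R) := φ.toEquiv.nontrivial
  refine ⟨fun {a b} hab => ?_⟩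
  have := h.isUnit_or_isUnit_of_add_one (a := φ a) (b := φ b) (by rw [← map_add, hab, map_one])
  simpa using this

end LocalRing

/-! ### Normal forms in y, z and admissibility of the relations. -/

section Nilpotent

variable {k : Type*} [Field k] {A : Type*} [Ring A] [Algebra k A]

/-- This moves z to the right past powers of y without changing the total degree. The parameter ε
treats Λ₁ (ε = 0) and Λ₂ (ε = 1) together. -/
theorem mul_pow_of_commutator_eq {y z : A} {ε : k} (h : y * z = z * y + ε • y ^ 2) (n : ℕ) :
    z * y ^ n = y ^ n * z - (n * ε) • y ^ (n + 1) := by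
  induction n with
  | zero => simp
  | succ n ih =>
    have h' : z * y = y * z - ε • y ^ 2 := eq_sub_of_add_eq h.symm
    rw [pow_succ, ← mul_assoc, ih, sub_mul, mul_assoc, h', mul_sub, smul_mul_assoc, mul_smul_comm,
      ← pow_add, ← pow_succ, ← mul_assoc, Nat.cast_succ, add_mul, add_smul, one_mul, sub_sub,
      add_comm (ε • _)]

theorem pathProd_mem_span {f : Gen2 → A} {ε : k}
    (h : f Gen2.y * f Gen2.z = f Gen2.z * f Gen2.y + ε • f Gen2.y ^ 2)
    {a b : Bouquet Gen2} (q : Quiver.Path a b) :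
    pathProd (V := Bouquet Gen2) (fun _ _ x => f x) q ∈
      Submodule.span k {x | ∃ i j, i + j = q.length ∧ x = f Gen2.y ^ i * f Gen2.z ^ j} := by
  induction q with
  | nil => exact Submodule.subset_span ⟨0, 0, rfl, by simp [pathProd]⟩
  | cons q e ih =>
    rw [pathProd, Quiver.Path.length_cons]
    generalize pathProd (V := Bouquet Gen2) (fun _ _ x => f x) q = r at ih
    -- The arrow `e` is restated as an element of `Gen2`, on which cases can be taken.
    suffices key : ∀ x : Gen2, f x * r ∈ Submodule.span k
        {x | ∃ i j, i + j = q.length + 1 ∧ x = f Gen2.y ^ i * f Gen2.z ^ j} from key e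
    intro x
    induction ih using Submodule.span_induction with
    | zero => simp
    | add y₁ y₂ _ _ h₁ h₂ => rw [mul_add]; exact add_mem h₁ h₂
    | smul r y _ h => rw [mul_smul_comm]; exact Submodule.smul_mem _ _ h
    | mem r hr =>
      obtain ⟨i, j, hij, rfl⟩ := hr
      cases x with
      | y => exact Submodule.subset_span ⟨i + 1, j, by omega, by rw [← mul_assoc, pow_succ']⟩
      | z =>
        rw [← mul_assoc, mul_pow_of_commutator_eq h, sub_mul, mul_assoc, ← pow_succ',
          smul_mul_assoc]
        exact sub_mem (Submodule.subset_span ⟨i, j + 1, by omega, rfl⟩)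
          (Submodule.smul_mem _ _ (Submodule.subset_span ⟨i + 1, j, by omega, rfl⟩))

/-- If i + j ≥ 2p, then i ≥ p or j ≥ p, so every monomial y^i z^j of that degree vanishes. -/
theorem pathProd_eq_zero {p : ℕ} {f : Gen2 → A} {ε : k}
    (h : f Gen2.y * f Gen2.z = f Gen2.z * f Gen2.y + ε • f Gen2.y ^ 2)
    (hy : f Gen2.y ^ p = 0) (hz : f Gen2.z ^ p = 0) {a b : Bouquet Gen2} (q : Quiver.Path a b)
    (hq : 2 * p ≤ q.length) : pathProd (V := Bouquet Gen2) (fun _ _ x => f x) q = 0 := by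
  have hle : Submodule.span k {x | ∃ i j, i + j = q.length ∧ x = f Gen2.y ^ i * f Gen2.z ^ j} ≤
      ⊥ := by
    rw [Submodule.span_le]
    rintro _ ⟨i, j, hij, rfl⟩
    rw [SetLike.mem_coe, Submodule.mem_bot]
    by_cases hi : p ≤ i
    · rw [pow_eq_zero_of_le hi hy, zero_mul]
    · rw [pow_eq_zero_of_le (by omega : p ≤ j) hz, mul_zero]
  exact (Submodule.mem_bot k).1 (hle (pathProd_mem_span h q))

/-- An ideal containing `y ^ p`, `z ^ p` and `y z - z y - ε y ^ 2`, and generated by elements of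
the square of the arrow ideal, is admissible. -/
theorem isAdmissible_of_relations {p : ℕ} (hp : 1 ≤ p) {S : Set (PathAlgebra k (Bouquet Gen2))}
    (hS : ∀ s ∈ S, s ∈ arrowIdeal k (Bouquet Gen2) ^ 2) (ε : k)
    (hy : loop k Gen2.y ^ p ∈ TwoSidedIdeal.span S) (hz : loop k Gen2.z ^ p ∈ TwoSidedIdeal.span S)
    (hyz : loop k Gen2.y * loop k Gen2.z - (loop k Gen2.z * loop k Gen2.y + ε • loop k Gen2.y ^ 2) ∈
      TwoSidedIdeal.span S) :
    IsAdmissible (TwoSidedIdeal.span S) := by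
  let π := (TwoSidedIdeal.span S).ringCon.mkₐ (α := k)
  -- Written as an evaluation at the classes of the loops, the projection sends a path to a
  -- `pathProd`, to which the normal form applies.
  have hπ : π = bouquetLift k fun x => π (loop k x) :=
    bouquet_algHom_ext fun x => (bouquetLift_loop (k := k) (fun x => π (loop k x)) x).symm
  refine ⟨⟨2 * p, by omega, fun x hx => ?_⟩, fun x hx => ?_⟩
  · rw [← mk_eq_zero_iff (k := k)]
    have hx' := arrowIdeal_pow_le_span _ hx
    clear hx
    induction hx' using Submodule.span_induction with
    | zero => simp
    | add y₁ y₂ _ _ h₁ h₂ => rw [map_add, h₁, h₂, add_zero]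
    | smul r y _ h => rw [map_smul, h, smul_zero]
    | mem x hx =>
      obtain ⟨a, b, q, hq, rfl⟩ := hx
      change π _ = 0
      rw [hπ, bouquetLift_ofPath]
      refine pathProd_eq_zero (k := k) (ε := ε) ?_ ?_ ?_ q hq
      · rw [← sub_eq_zero, ← map_pow, ← map_mul, ← map_mul, ← map_smul, ← map_add, ← map_sub]
        exact (mk_eq_zero_iff (k := k) _ _).2 hyz
      · rw [← map_pow]
        exact (mk_eq_zero_iff (k := k) _ _).2 hy
      · rw [← map_pow]
        exact (mk_eq_zero_iff (k := k) _ _).2 hz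
  · have hle : TwoSidedIdeal.span S ≤ arrowIdealSq k (Bouquet Gen2) :=
      TwoSidedIdeal.span_le.2 fun s hs => mem_arrowIdealSq.2 (hS s hs)
    exact mem_arrowIdealSq.1 (hle hx)

end Nilpotent

/-! ### Weight-homogeneous elements. -/

section Homogeneous

variable {k : Type*} [Field k] {V : Type u} [Quiver.{v} V] {G : Type*} [Group G]
  {w : ∀ ⦃a b : V⦄, (a ⟶ b) → G}

theorem IsWeightHomogeneous.add {g : G} {x y : PathAlgebra k V} (hx : IsWeightHomogeneous w g x)
    (hy : IsWeightHomogeneous w g y) : IsWeightHomogeneous w g (x + y) := by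
  classical
  intro q hq
  rw [map_add] at hq
  rcases Finset.mem_union.1 (Finsupp.support_add hq) with h | h
  · exact hx q h
  · exact hy q h

theorem IsWeightHomogeneous.smul {g : G} {x : PathAlgebra k V} (r : k)
    (hx : IsWeightHomogeneous w g x) : IsWeightHomogeneous w g (r • x) := by
  intro q hq
  rw [map_smul] at hq
  exact hx q (Finsupp.support_smul hq)

theorem IsWeightHomogeneous.sub {g : G} {x y : PathAlgebra k V} (hx : IsWeightHomogeneous w g x)
    (hy : IsWeightHomogeneous w g y) : IsWeightHomogeneous w g (x - y) := by
  rw [sub_eq_add_neg, ← neg_one_smul k y]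
  exact hx.add (hy.smul _)

theorem isWeightHomogeneous_zero (g : G) : IsWeightHomogeneous w g (0 : PathAlgebra k V) := by
  intro q hq
  simp at hq

theorem isWeightHomogeneous_ofPath {a b : V} (q : Quiver.Path a b) :
    IsWeightHomogeneous w (pathWeight w q) (ofPath k q) := by
  classical
  intro l hl
  rw [ofPath, Module.Basis.repr_self] at hl
  have := Finset.mem_singleton.1 (Finsupp.support_single_subset hl)
  subst this
  rfl

theorem isWeightHomogeneous_iff_mem_span {g : G} {x : PathAlgebra k V} :
    IsWeightHomogeneous w g x ↔ x ∈ Submodule.span k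
      {y | ∃ (a b : V) (q : Quiver.Path a b), pathWeight w q = g ∧ y = ofPath k q} := by
  constructor
  · intro h
    rw [← (pathBasis k V).linearCombination_repr x, Finsupp.linearCombination_apply]
    exact sum_mem fun q hq => Submodule.smul_mem _ _
      (Submodule.subset_span ⟨q.source, q.target, q.path, h q hq, rfl⟩)
  · intro h
    induction h using Submodule.span_induction with
    | zero => exact isWeightHomogeneous_zero g
    | add _ _ _ _ h₁ h₂ => exact h₁.add h₂
    | smul r _ _ h => exact h.smul r
    | mem x hx =>
      obtain ⟨a, b, q, rfl, rfl⟩ := hx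
      exact isWeightHomogeneous_ofPath q

/-- The weights multiply in the opposite order, because in x * y the paths of y run first. -/
theorem IsWeightHomogeneous.mul [Fintype V] {g h : G} {x y : PathAlgebra k V}
    (hx : IsWeightHomogeneous w g x) (hy : IsWeightHomogeneous w h y) :
    IsWeightHomogeneous w (h * g) (x * y) := by
  rw [isWeightHomogeneous_iff_mem_span] at hx hy ⊢
  have hxy := Submodule.mul_mem_mul hx hy
  rw [Submodule.span_mul_span] at hxy
  refine Submodule.span_le.2 ?_ hxy
  rintro _ ⟨_, ⟨a, b, q, rfl, rfl⟩, _, ⟨c, d, l, rfl, rfl⟩, rfl⟩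
  change ofPath k q * ofPath k l ∈ _
  by_cases h : d = a
  · subst h
    rw [ofPath_mul_ofPath]
    exact Submodule.subset_span ⟨_, _, _, Quiver.Path.weight_comp _ _ _, rfl⟩
  · rw [ofPath_mul_ofPath_of_ne k _ _ h]
    exact zero_mem _

theorem isWeightHomogeneous_loop {X : Type v} (w : X → G) (x : X) :
    IsWeightHomogeneous (fun _ _ (x : X) => w x) (w x) (loop k x) := by
  have h := isWeightHomogeneous_ofPath (k := k) (w := fun (_ _ : Bouquet X) (x : X) => w x)
    (Quiver.Hom.toPath (show (Bouquet.pt : Bouquet X) ⟶ Bouquet.pt from x))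
  have h1 : pathWeight (fun (_ _ : Bouquet X) (x : X) => w x)
      (Quiver.Hom.toPath (show (Bouquet.pt : Bouquet X) ⟶ Bouquet.pt from x)) = w x :=
    (pathWeight_cons _ _ _).trans (by rw [pathWeight_nil, one_mul])
  rwa [h1] at h

theorem isWeightHomogeneous_loop_pow {X : Type v} (w : X → G) (x : X) (n : ℕ) :
    IsWeightHomogeneous (fun _ _ (x : X) => w x) (w x ^ n) (loop k x ^ n) := by
  induction n with
  | zero =>
    rw [pow_zero, pow_zero, ← ofPath_nil (k := k) Bouquet.pt]
    have h := isWeightHomogeneous_ofPath (k := k) (w := fun (_ _ : Bouquet X) (x : X) => w x)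
      (Quiver.Path.nil : Quiver.Path (Bouquet.pt : Bouquet X) Bouquet.pt)
    rwa [pathWeight_nil] at h
  | succ n ih =>
    rw [pow_succ (loop k x), pow_succ']
    exact ih.mul (isWeightHomogeneous_loop w x)

end Homogeneous

/-! ### The character of G and the integer a. -/

section Characters

variable {k : Type*} [Field k] {p : ℕ} [CharP k p] {G : Type*} [Group G] [Fintype G]

/-- As σ has order p, its exponents are defined modulo p, and reduction to k is well defined and
injective. The values are fixed by Frobenius. -/
theorem exists_isRootCharacter (hp : p.Prime) (hG : Fintype.card G = p) {σ : G}
    (hσ : Subgroup.zpowers σ = ⊤) :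
    ∃ χ : G → k, IsRootCharacter p χ ∧ ∀ n : ℤ, χ (σ ^ n) = n := by
  have : Fact p.Prime := ⟨hp⟩
  have hgen : ∀ g : G, ∃ n : ℤ, σ ^ n = g := fun g =>
    Subgroup.mem_zpowers_iff.1 (hσ ▸ Subgroup.mem_top g)
  have hord : orderOf σ = p := by
    rw [← hG, ← Nat.card_eq_fintype_card]
    exact orderOf_eq_card_of_forall_mem_zpowers fun g => hσ ▸ Subgroup.mem_top g
  choose ℓ hℓ using hgen
  have hχ : ∀ n : ℤ, ((ℓ (σ ^ n) : ℤ) : k) = n := fun n => by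
    have h := hℓ (σ ^ n)
    rwa [zpow_eq_zpow_iff_modEq, hord, ← CharP.intCast_eq_intCast k p] at h
  refine ⟨fun g => (ℓ g : k), ⟨hp.one_lt, hG, fun g h => ?_, fun g h hgh => ?_, fun g => ?_⟩, hχ⟩
  · have := hχ (ℓ g + ℓ h)
    rwa [zpow_add, hℓ, hℓ, Int.cast_add] at this
  · rw [← hℓ g, ← hℓ h, zpow_eq_zpow_iff_modEq, hord, ← CharP.intCast_eq_intCast k p]
    exact hgh
  · exact map_intCast (frobenius k p) _

/-- From c^p = ±c it follows that (c²)^p = c², so c⁻² is fixed by Frobenius and lies in the prime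
field. -/
theorem exists_intCast_eq_of_pow_eq (hp : p.Prime) {c : k}
    (h : c ^ (p - 1) = 1 ∨ c ^ (p - 1) = -1) : ∃ n : ℤ, (n : k) = (c ^ 2)⁻¹ := by
  have : Fact p.Prime := ⟨hp⟩
  rw [← mem_bot_iff_intCast p, Subfield.mem_bot_iff_pow_eq_self, inv_pow, ← pow_mul, mul_comm,
    pow_mul]
  congr 1
  rcases h with h | h <;> simp [← pow_sub_one_mul hp.ne_zero c, h]

theorem existsUnique_inv_eq_natCast_mul (hp : p.Prime) {c : k} (hc : c ≠ 0)
    (h : c ^ (p - 1) = 1 ∨ c ^ (p - 1) = -1) :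
    ∃! a : ℕ, 1 ≤ a ∧ a < p ∧ c⁻¹ = (a : k) * c := by
  obtain ⟨n, hn⟩ := exists_intCast_eq_of_pow_eq hp h
  have hp0 : (0 : ℤ) < p := by exact_mod_cast hp.pos
  have hcast : (((n % p).toNat : ℕ) : k) = (c ^ 2)⁻¹ := by
    rw [← hn, ← Int.cast_natCast, Int.toNat_of_nonneg (Int.emod_nonneg _ hp0.ne'),
      CharP.intCast_eq_intCast k p]
    exact Int.mod_modEq n p
  -- The condition on a says that a = c⁻² in k. The least nonnegative residue works, and it is
  -- positive because c⁻² ≠ 0.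
  refine ⟨(n % p).toNat, ⟨?_, ?_, ?_⟩, ?_⟩
  · rw [Nat.one_le_iff_ne_zero]
    intro h0
    rw [h0, Nat.cast_zero] at hcast
    exact inv_ne_zero (pow_ne_zero 2 hc) hcast.symm
  · have := Int.emod_lt_of_pos n hp0
    omega
  · rw [hcast]
    field_simp
  · rintro b ⟨-, hb, hbc⟩
    refine CharP.natCast_injOn_Iio k p hb ?_ ?_
    · have := Int.emod_lt_of_pos n hp0
      have := Int.emod_nonneg n hp0.ne'
      change (n % p).toNat < p
      omega
    · rw [hcast]
      exact eq_inv_of_mul_eq_one_left (by rw [pow_two, ← mul_assoc, ← hbc, inv_mul_cancel₀ hc])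

end Characters

/-! ### The defining relations spelled out, with their admissibility and homogeneity. -/

section Relations

variable {k : Type*} [Field k] {p : ℕ} {A : Type*} [Ring A] [Algebra k A]

theorem forall_relB1_iff {m : Gen3 → A} :
    (∀ r ∈ relB1 k p, FreeAlgebra.lift k m r = 0) ↔
      (m .x * m .y - m .y * m .x) - m .y = 0 ∧ m .x * m .z - m .z * m .x = 0 ∧
      m .y * m .z - m .z * m .y = 0 ∧ m .x ^ p - m .x = 0 ∧ m .y ^ p = 0 ∧ m .z ^ p = 0 := by
  simp [relB1]

theorem forall_relB3_iff {m : Gen3 → A} :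
    (∀ r ∈ relB3 k p, FreeAlgebra.lift k m r = 0) ↔
      (m .x * m .y - m .y * m .x) - m .y = 0 ∧ (m .x * m .z - m .z * m .x) - m .z = 0 ∧
      (m .y * m .z - m .z * m .y) - m .y ^ 2 = 0 ∧ m .x ^ p - m .x = 0 ∧ m .y ^ p = 0 ∧
      m .z ^ p = 0 := by
  simp [relB3]

theorem forall_relC16_iff {c δ : k} {m : Gen3 → A} :
    (∀ r ∈ relC16 k p c δ, FreeAlgebra.lift k m r = 0) ↔
      m .x * m .y - m .y * m .x = 0 ∧ (m .x * m .z - m .z * m .x) - c • m .x = 0 ∧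
      (m .y * m .z - m .z * m .y) - c⁻¹ • m .y = 0 ∧ m .x ^ p = 0 ∧ m .y ^ p = 0 ∧
      m .z ^ p - δ • m .z = 0 := by
  simp [relC16]

theorem forall_relΛ₁_iff {m : Gen2 → A} :
    (∀ r ∈ relΛ₁ k p, FreeAlgebra.lift k m r = 0) ↔
      m .y ^ p = 0 ∧ m .y * m .z - m .z * m .y = 0 ∧ m .z ^ p = 0 := by
  simp [relΛ₁]

theorem forall_relΛ₂_iff {m : Gen2 → A} :
    (∀ r ∈ relΛ₂ k p, FreeAlgebra.lift k m r = 0) ↔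
      m .y ^ p = 0 ∧ m .y * m .z - m .z * m .y - m .y ^ 2 = 0 ∧ m .z ^ p = 0 := by
  simp [relΛ₂]

theorem mul_loop_mem_sq (x x' : Gen2) :
    loop k x * loop k x' ∈ arrowIdeal k (Bouquet Gen2) ^ 2 := by
  rw [pow_two]
  exact Submodule.mul_mem_mul (loop_mem_arrowIdeal x) (loop_mem_arrowIdeal x')

theorem loop_pow_mem_sq (hp : 2 ≤ p) (x : Gen2) :
    loop k x ^ p ∈ arrowIdeal k (Bouquet Gen2) ^ 2 := by
  obtain ⟨n, rfl⟩ := Nat.exists_eq_add_of_le hp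
  rw [pow_add, ← mem_arrowIdealSq]
  exact TwoSidedIdeal.mul_mem_right _ _ _ (mem_arrowIdealSq.2 (by
    rw [pow_two (loop k x)]; exact mul_loop_mem_sq x x))

theorem lift_loop_mem_relationIdeal {R : Set (FreeAlgebra k Gen2)} {r : FreeAlgebra k Gen2}
    (hr : r ∈ R) : FreeAlgebra.lift k (loop k) r ∈ relationIdeal R :=
  TwoSidedIdeal.subset_span ⟨r, hr, rfl⟩

theorem isAdmissible_relΛ₁ (hp : 2 ≤ p) : IsAdmissible (relationIdeal (relΛ₁ k p)) := by
  refine isAdmissible_of_relations (p := p) (by omega) ?_ 0 ?_ ?_ ?_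
  · rintro _ ⟨r, hr, rfl⟩
    rcases hr with rfl | rfl | rfl
    · simpa using loop_pow_mem_sq hp Gen2.y
    · simpa using sub_mem (mul_loop_mem_sq (k := k) Gen2.y Gen2.z) (mul_loop_mem_sq Gen2.z Gen2.y)
    · simpa using loop_pow_mem_sq hp Gen2.z
  · change _ ∈ relationIdeal (relΛ₁ k p)
    simpa using lift_loop_mem_relationIdeal (R := relΛ₁ k p) (Or.inl rfl)
  · change _ ∈ relationIdeal (relΛ₁ k p)
    simpa using lift_loop_mem_relationIdeal (R := relΛ₁ k p) (Or.inr (Or.inr rfl))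
  · change _ ∈ relationIdeal (relΛ₁ k p)
    simpa using lift_loop_mem_relationIdeal (R := relΛ₁ k p) (Or.inr (Or.inl rfl))

theorem isAdmissible_relΛ₂ (hp : 2 ≤ p) : IsAdmissible (relationIdeal (relΛ₂ k p)) := by
  refine isAdmissible_of_relations (p := p) (by omega) ?_ 1 ?_ ?_ ?_
  · rintro _ ⟨r, hr, rfl⟩
    rcases hr with rfl | rfl | rfl
    · simpa using loop_pow_mem_sq hp Gen2.y
    · simpa using sub_mem (sub_mem (mul_loop_mem_sq (k := k) Gen2.y Gen2.z)
        (mul_loop_mem_sq Gen2.z Gen2.y)) (loop_pow_mem_sq le_rfl Gen2.y)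
    · simpa using loop_pow_mem_sq hp Gen2.z
  · change _ ∈ relationIdeal (relΛ₂ k p)
    simpa using lift_loop_mem_relationIdeal (R := relΛ₂ k p) (Or.inl rfl)
  · change _ ∈ relationIdeal (relΛ₂ k p)
    simpa using lift_loop_mem_relationIdeal (R := relΛ₂ k p) (Or.inr (Or.inr rfl))
  · change _ ∈ relationIdeal (relΛ₂ k p)
    simpa [sub_sub] using lift_loop_mem_relationIdeal (R := relΛ₂ k p) (Or.inr (Or.inl rfl))

variable {G : Type*} [Group G]

theorem exists_isWeightHomogeneous_relΛ₁ (w : Gen2 → G) (hw : Commute (w .y) (w .z)) :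
    ∀ r ∈ relΛ₁ k p, ∃ g : G, IsWeightHomogeneous (fun (_ _ : Bouquet Gen2) (x : Gen2) => w x) g
      (FreeAlgebra.lift k (loop k) r) := by
  rintro r (rfl | rfl | rfl)
  · exact ⟨_, by simpa using isWeightHomogeneous_loop_pow w Gen2.y p⟩
  · refine ⟨w .z * w .y, ?_⟩
    have h1 := (isWeightHomogeneous_loop (k := k) w .y).mul (isWeightHomogeneous_loop w .z)
    have h2 := (isWeightHomogeneous_loop (k := k) w .z).mul (isWeightHomogeneous_loop w .y)
    rw [hw.eq] at h2
    simpa using h1.sub h2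
  · exact ⟨_, by simpa using isWeightHomogeneous_loop_pow w Gen2.z p⟩

/-- The terms yz, zy and y² all have weight w(y)² because the two loops have equal weights. -/
theorem exists_isWeightHomogeneous_relΛ₂ (w : Gen2 → G) (hw : w .y = w .z) :
    ∀ r ∈ relΛ₂ k p, ∃ g : G, IsWeightHomogeneous (fun (_ _ : Bouquet Gen2) (x : Gen2) => w x) g
      (FreeAlgebra.lift k (loop k) r) := by
  rintro r (rfl | rfl | rfl)
  · exact ⟨_, by simpa using isWeightHomogeneous_loop_pow w Gen2.y p⟩
  · refine ⟨w .y ^ 2, ?_⟩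
    have h1 := (isWeightHomogeneous_loop (k := k) w .y).mul (isWeightHomogeneous_loop w .z)
    have h2 := (isWeightHomogeneous_loop (k := k) w .z).mul (isWeightHomogeneous_loop w .y)
    have h3 := isWeightHomogeneous_loop_pow (k := k) w .y 2
    rw [← hw, ← pow_two] at h1 h2
    simpa using (h1.sub h2).sub h3
  · exact ⟨_, by simpa using isWeightHomogeneous_loop_pow w Gen2.z p⟩

end Relations

/-! ### Criterion for a presented algebra to be a covering. -/

section PresentedCovering

variable {k : Type*} [Field k] {X : Type v} {G : Type*} [Group G] [Fintype G] {w : X → G}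
  {p : ℕ} {χ : G → k}

/-- The generator `t` is to become c·T, and the generators `i x` the f_x. The two main hypotheses
translate the relations S into those of the covering and back; the scalar c is 1 for B1 and B3, and
λ for C16. -/
theorem isCoveringOfLocal_presented (hχ : IsRootCharacter p χ) {R : Set (FreeAlgebra k X)}
    (adm : IsAdmissible (relationIdeal R))
    (hom : ∀ r ∈ R, ∃ g : G, IsWeightHomogeneous (fun (_ _ : Bouquet X) (x : X) => w x) g
      (FreeAlgebra.lift k (loop k) r))
    {Y : Type*} {S : Set (FreeAlgebra k Y)} (t : Y) (i : X → Y) {c : k} (hc : c ≠ 0)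
    (h_of_rel : ∀ m : Y → Presented S, (∀ s ∈ S, FreeAlgebra.lift k m s = 0) →
      (c⁻¹ • m t) ^ p = c⁻¹ • m t ∧
      (∀ x, (c⁻¹ • m t) * m (i x) = m (i x) * (c⁻¹ • m t) + χ (w x) • m (i x)) ∧
      ∀ r ∈ R, FreeAlgebra.lift k (fun x => m (i x)) r = 0)
    (h_exists : ∀ (T' : (liftIdeal (fun _ _ (x : X) => w x) (relationIdeal R)).ringCon.Quotient)
      (f' : X → (liftIdeal (fun _ _ (x : X) => w x) (relationIdeal R)).ringCon.Quotient),
      T' ^ p = T' → (∀ x, T' * f' x = f' x * T' + χ (w x) • f' x) →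
      (∀ r ∈ R, FreeAlgebra.lift k f' r = 0) →
      ∃ m : Y → (liftIdeal (fun _ _ (x : X) => w x) (relationIdeal R)).ringCon.Quotient,
        m t = c • T' ∧ (∀ x, m (i x) = f' x) ∧ ∀ s ∈ S, FreeAlgebra.lift k m s = 0)
    (hgen : ∀ y, y = t ∨ ∃ x, y = i x) :
    IsCoveringOfLocal (Presented S) R w := by
  refine ⟨isLocalRing_presented adm, exists_presented_algEquiv R, adm,
    ⟨_, by rintro _ ⟨r, hr, rfl⟩; exact hom r hr, rfl⟩, ?_⟩
  let m : Y → Presented S := fun y =>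
    (TwoSidedIdeal.span S).ringCon.mkₐ (α := k) (FreeAlgebra.ι k y)
  obtain ⟨hT, hf, hR⟩ := h_of_rel m fun s hs => mk_presented_eq_zero hs
  refine nonempty_algEquiv_covering hχ hom hT (fun x => (hf x).trans
    (by rw [mul_add, ← Algebra.commutes, ← Algebra.smul_def])) hR (fun T' f' hT' hf' hR' => ?_)
    fun h hT hf => ?_
  · obtain ⟨m', hm't, hm'i, hm'⟩ := h_exists T' f' hT'
      (fun x => (hf' x).trans (by rw [mul_add, ← Algebra.commutes, ← Algebra.smul_def])) hR'
    have key : ∀ y, quotientSpanLift S (FreeAlgebra.lift k m') hm' (m y) = m' y := fun y =>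
      (quotientSpanLift_mk _ _ _ _).trans (FreeAlgebra.lift_ι_apply _ _)
    refine ⟨quotientSpanLift S (FreeAlgebra.lift k m') hm', ?_, fun x => ?_⟩
    · rw [map_smul, key, hm't, inv_smul_smul₀ hc]
    · rw [key, hm'i]
  · refine RingCon.Quotient.hom_extₐ (FreeAlgebra.hom_ext (funext fun y => ?_))
    change h (m y) = m y
    rcases hgen y with rfl | ⟨x, rfl⟩
    · rw [map_smul] at hT
      exact smul_right_injective _ (inv_ne_zero hc) hT
    · exact hf x

end PresentedCovering

/-! ### The algebras B1, B3 and C16. -/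

section Coverings

variable {k : Type*} [Field k] {p : ℕ} {G : Type*} [Group G] [Fintype G] {χ : G → k}
  {w : Gen2 → G}

/-- The inclusion of the generators `y, z` as `y, z`. -/
def genYZ : Gen2 → Gen3
  | .y => .y
  | .z => .z

/-- The inclusion of the generators `y, z` as `x, y`. -/
def genXY : Gen2 → Gen3
  | .y => .x
  | .z => .y

/-- The values on `x, y, z` given by an element for `x` and a function on `y, z`. -/
def elimYZ {A : Type*} (a : A) (f : Gen2 → A) : Gen3 → A
  | .x => a
  | .y => f .y
  | .z => f .z

/-- The values on `x, y, z` given by a function for `x, y` and an element for `z`. -/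
def elimXY {A : Type*} (a : A) (f : Gen2 → A) : Gen3 → A
  | .x => f .y
  | .y => f .z
  | .z => a

theorem eq_x_or_exists_genYZ (g : Gen3) : g = .x ∨ ∃ x, g = genYZ x := by
  rcases g with _ | _ | _
  exacts [Or.inl rfl, Or.inr ⟨.y, rfl⟩, Or.inr ⟨.z, rfl⟩]

theorem eq_z_or_exists_genXY (g : Gen3) : g = .z ∨ ∃ x, g = genXY x := by
  rcases g with _ | _ | _
  exacts [Or.inr ⟨.y, rfl⟩, Or.inr ⟨.z, rfl⟩, Or.inl rfl]

theorem isCoveringOfLocal_relB1 (hχ : IsRootCharacter p χ) (hw : Commute (w .y) (w .z))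
    (hwy : χ (w .y) = 1) (hwz : χ (w .z) = 0) :
    IsCoveringOfLocal (Presented (relB1 k p)) (relΛ₁ k p) w := by
  refine isCoveringOfLocal_presented hχ (isAdmissible_relΛ₁ hχ.one_lt)
    (exists_isWeightHomogeneous_relΛ₁ w hw) Gen3.x genYZ one_ne_zero (fun m hm => ?_)
    (fun T f hT hf hR => ?_) eq_x_or_exists_genYZ
  · obtain ⟨hxy, hxz, hyz, hx, hy, hz⟩ := forall_relB1_iff.1 hm
    rw [inv_one, one_smul]
    refine ⟨sub_eq_zero.1 hx, ?_, forall_relΛ₁_iff.2 ⟨hy, hyz, hz⟩⟩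
    rintro (_ | _)
    · rw [hwy, one_smul, ← sub_eq_zero, ← sub_sub]
      exact hxy
    · rw [hwz, zero_smul, add_zero, ← sub_eq_zero]
      exact hxz
  · obtain ⟨hy, hyz, hz⟩ := forall_relΛ₁_iff.1 hR
    have hfy := hf .y
    have hfz := hf .z
    rw [hwy, one_smul] at hfy
    rw [hwz, zero_smul, add_zero] at hfz
    refine ⟨elimYZ T f, (one_smul k T).symm, by rintro (_ | _) <;> rfl,
      forall_relB1_iff.2 ⟨?_, sub_eq_zero.2 hfz, hyz, sub_eq_zero.2 hT, hy, hz⟩⟩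
    rw [sub_sub]
    exact sub_eq_zero.2 hfy

theorem isCoveringOfLocal_relB3 (hχ : IsRootCharacter p χ) (hw : w .y = w .z)
    (hwy : χ (w .y) = 1) : IsCoveringOfLocal (Presented (relB3 k p)) (relΛ₂ k p) w := by
  refine isCoveringOfLocal_presented hχ (isAdmissible_relΛ₂ hχ.one_lt)
    (exists_isWeightHomogeneous_relΛ₂ w hw) Gen3.x genYZ one_ne_zero (fun m hm => ?_)
    (fun T f hT hf hR => ?_) eq_x_or_exists_genYZ
  · obtain ⟨hxy, hxz, hyz, hx, hy, hz⟩ := forall_relB3_iff.1 hm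
    rw [inv_one, one_smul]
    refine ⟨sub_eq_zero.1 hx, ?_, forall_relΛ₂_iff.2 ⟨hy, hyz, hz⟩⟩
    rintro (_ | _)
    · rw [hwy, one_smul, ← sub_eq_zero, ← sub_sub]
      exact hxy
    · rw [← hw, hwy, one_smul, ← sub_eq_zero, ← sub_sub]
      exact hxz
  · obtain ⟨hy, hyz, hz⟩ := forall_relΛ₂_iff.1 hR
    have hfy := hf .y
    have hfz := hf .z
    rw [hwy, one_smul] at hfy
    rw [← hw, hwy, one_smul] at hfz
    refine ⟨elimYZ T f, (one_smul k T).symm, by rintro (_ | _) <;> rfl,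
      forall_relB3_iff.2 ⟨?_, ?_, hyz, sub_eq_zero.2 hT, hy, hz⟩⟩
    · rw [sub_sub]
      exact sub_eq_zero.2 hfy
    · rw [sub_sub]
      exact sub_eq_zero.2 hfz

/-- Here T = c⁻¹z. Dividing the commutators with z by c gives the shifts −1 for x and −c⁻² for y;
the minus signs arise because z stands on the right in [x,z] and [y,z]. -/
theorem isCoveringOfLocal_relC16 (hχ : IsRootCharacter p χ) (hw : Commute (w .y) (w .z)) {c δ : k}
    (hc : c ≠ 0) (hδ : δ = c ^ (p - 1)) (hwy : χ (w .y) = -1) (hwz : χ (w .z) = -(c⁻¹ * c⁻¹)) :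
    IsCoveringOfLocal (Presented (relC16 k p c δ)) (relΛ₁ k p) w := by
  have hp0 : p ≠ 0 := by have := hχ.one_lt; omega
  have hcp : c ^ p = δ * c := by rw [hδ, pow_sub_one_mul hp0]
  have hδ0 : δ ≠ 0 := hδ ▸ pow_ne_zero _ hc
  refine isCoveringOfLocal_presented hχ (isAdmissible_relΛ₁ hχ.one_lt)
    (exists_isWeightHomogeneous_relΛ₁ w hw) Gen3.z genXY hc (fun m hm => ?_)
    (fun T f hT hf hR => ?_) eq_z_or_exists_genXY
  · obtain ⟨hxy, hxz, hyz, hx, hy, hz⟩ := forall_relC16_iff.1 hm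
    refine ⟨?_, ?_, forall_relΛ₁_iff.2 ⟨hx, hxy, hy⟩⟩
    -- T^p = c⁻ᵖ δ z = c⁻¹ z, because c^p = δc.
    · rw [smul_pow, sub_eq_zero.1 hz, smul_smul, inv_pow, hcp, mul_inv_rev, mul_assoc,
        inv_mul_cancel₀ hδ0, mul_one]
    · rintro (_ | _)
      · have h : m .z * m .x = m .x * m .z - c • m .x := by
          rw [eq_sub_iff_add_eq, add_comm, ← eq_sub_iff_add_eq, eq_comm, ← sub_eq_zero]
          exact hxz
        change (c⁻¹ • m .z) * m .x = m .x * (c⁻¹ • m .z) + _ • m .x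
        rw [hwy, smul_mul_assoc, h, smul_sub, inv_smul_smul₀ hc, mul_smul_comm, neg_one_smul,
          sub_eq_add_neg]
      · have h : m .z * m .y = m .y * m .z - c⁻¹ • m .y := by
          rw [eq_sub_iff_add_eq, add_comm, ← eq_sub_iff_add_eq, eq_comm, ← sub_eq_zero]
          exact hyz
        change (c⁻¹ • m .z) * m .y = m .y * (c⁻¹ • m .z) + _ • m .y
        rw [hwz, smul_mul_assoc, h, smul_sub, smul_smul, mul_smul_comm, neg_smul, sub_eq_add_neg]
  · obtain ⟨hy, hyz, hz⟩ := forall_relΛ₁_iff.1 hR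
    have hfy := hf .y
    have hfz := hf .z
    rw [hwy, neg_one_smul] at hfy
    rw [hwz] at hfz
    refine ⟨elimXY (c • T) f, rfl, by rintro (_ | _) <;> rfl,
      forall_relC16_iff.2 ⟨hyz, ?_, ?_, hy, hz, ?_⟩⟩
    · change f .y * (c • T) - (c • T) * f .y - c • f .y = 0
      rw [mul_smul_comm, smul_mul_assoc, hfy, smul_add, smul_neg]
      abel
    · change f .z * (c • T) - (c • T) * f .z - c⁻¹ • f .z = 0
      rw [mul_smul_comm, smul_mul_assoc, hfz, smul_add, smul_smul, mul_neg,
        mul_inv_cancel_left₀ hc, neg_smul]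
      abel
    · change (c • T) ^ p - δ • c • T = 0
      rw [smul_pow, hT, hcp, smul_smul, sub_self]

end Coverings

end PathCovering

/-! ### Assembly of the three statements. -/

theorem mainTheorem2 {p : ℕ} (hp : p.Prime) {k : Type*} [Field k] [CharP k p]
    {G : Type*} [Group G] [Fintype G] (hG : Fintype.card G = p)
    (σ : G) (hσ : Subgroup.zpowers σ = ⊤) :
    -- (a)
    (Nonempty (PathCovering.Presented (PathCovering.relB1 k p) ≃ₐ[k]
        PathCovering.Presented (PathCovering.relC11 k p)) ∧
      PathCovering.IsCoveringOfLocal (PathCovering.Presented (PathCovering.relB1 k p))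
        (PathCovering.relΛ₁ k p) (PathCovering.weights σ (1 : G)) ∧
      PathCovering.IsCoveringOfLocal (PathCovering.Presented (PathCovering.relC11 k p))
        (PathCovering.relΛ₁ k p) (PathCovering.weights σ (1 : G))) ∧
    -- (b)
    PathCovering.IsCoveringOfLocal (PathCovering.Presented (PathCovering.relB3 k p))
      (PathCovering.relΛ₂ k p) (PathCovering.weights σ σ) ∧
    -- (c)
    (∀ c δ : k, c ≠ 0 → δ = c ^ (p - 1) → (δ = 1 ∨ δ = -1) →
      (∃! a : ℕ, 1 ≤ a ∧ a < p ∧ c⁻¹ = (a : k) * c) ∧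
      ∀ a : ℤ, c⁻¹ = (a : k) * c →
        PathCovering.IsCoveringOfLocal (PathCovering.Presented (PathCovering.relC16 k p c δ))
          (PathCovering.relΛ₁ k p) (PathCovering.weights σ⁻¹ (σ ^ (-a)))) := by
  obtain ⟨χ, hχ, hχσ⟩ := PathCovering.exists_isRootCharacter (k := k) hp hG hσ
  have h0 : χ 1 = 0 := by simpa using hχσ 0
  have h1 : χ σ = 1 := by simpa using hχσ 1
  have h2 : χ σ⁻¹ = -1 := by simpa using hχσ (-1)
  have hB1 : PathCovering.IsCoveringOfLocal (PathCovering.Presented (PathCovering.relB1 k p))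
      (PathCovering.relΛ₁ k p) (PathCovering.weights σ (1 : G)) :=
    PathCovering.isCoveringOfLocal_relB1 hχ (Commute.one_right σ) h1 h0
  -- B1 and C11 have literally the same relations, so one proof serves both.
  refine ⟨⟨⟨AlgEquiv.refl⟩, hB1, hB1⟩, PathCovering.isCoveringOfLocal_relB3 hχ rfl h1,
    fun c δ hc hδ h => ⟨PathCovering.existsUnique_inv_eq_natCast_mul hp hc (hδ ▸ h),
      fun a ha => ?_⟩⟩
  refine PathCovering.isCoveringOfLocal_relC16 hχ ?_ hc hδ h2 ?_
  · exact ((Commute.refl σ).inv_left).zpow_right (-a)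
  · change χ (σ ^ (-a)) = _
    rw [hχσ, Int.cast_neg, neg_inj]
    -- Replacing only one factor of c⁻¹ * c⁻¹ by a·c lets the other cancel, leaving a.
    nth_rw 1 [ha]
    rw [mul_assoc, mul_inv_cancel₀ hc, mul_one]
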